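/- All graphs are finite and simple. Let $G=(V,E)$ be a graph and let $f=\{v_1,v_2\}$ be a non-edge of $G$, that is, a pair of distinct non-adjacent vertices; let $G\cup f=(V,E\cup\{f\})$. For a distance assignment $\delta:E\to[0,\infty)$, the 2D Cayley configuration space $\Phi_f^2(G,\delta)\subseteq\mathbb{R}$ is the set of all values $\|p(v_1)-p(v_2)\|$, where $p:V\to\mathbb{R}^2$ ranges over all maps with $\|p(u)-p(v)\|=\delta(uv)$ for every edge $uv\in E$. A graph $H$ is the 2-sum of subgraphs $H_1$ and $H_2$ if $H=H_1\cup H_2$ and $H_1\cap H_2$ is a complete graph $K_2$ (two vertices with the edge joining them) that is a proper subgraph of both $H_1$ and $H_2$. The 2-sum components of $H$ are $H$ itself and all subgraphs obtained from $H$ by repeatedly replacing a graph that is a 2-sum by one of its two summands. A minimal 2-sum component of $G\cup f$ containing $f$ is a subgraph that is minimal, with respect to the subgraph relation, among the 2-sum components of $G\cup f$ that contain both vertices of $f$. A 2-tree is a graph obtained from triangles $K_3$ by repeated 2-sums (a single triangle included), and a partial 2-tree is a graph isomorphic to a subgraph of a 2-tree. Then $\Phi_f^2(G,\delta)$ is a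 single interval (possibly empty, a single point, or unbounded) for every distance assignment $\delta$ if and only if every minimal 2-sum component of $G\cup f$ containing $f$ is a partial 2-tree. -/

import Mathlib

open scoped NNReal

/-- `p` is a `d`-dimensional realization of the linkage `(G, δ)`: a placement of the vertices in
`ℝ^d` in which every edge of `G` has its prescribed length. -/
def IsRealization {V : Type*} (d : ℕ) (G : SimpleGraph V) (δ : G.edgeSet → ℝ≥0)
    (p : V → EuclideanSpace ℝ (Fin d)) : Prop :=
  ∀ (u v : V) (h : G.Adj u v), dist (p u) (p v) = (δ ⟨s(u, v), h⟩ : ℝ)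

/-- The `d`-dimensional Cayley configuration space of `(G, δ)` on the pair `{v₁, v₂}`: the lengths
of this pair that are attained by the realizations of `(G, δ)`. -/
def cayleyConfigurationSpace {V : Type*} (d : ℕ) (G : SimpleGraph V) (v₁ v₂ : V)
    (δ : G.edgeSet → ℝ≥0) : Set ℝ :=
  {t | ∃ p : V → EuclideanSpace ℝ (Fin d), IsRealization d G δ p ∧ dist (p v₁) (p v₂) = t}

/-- The subgraph `B` is a complete graph on `k` vertices. -/
def IsCompleteOn {V : Type*} {H : SimpleGraph V} (k : ℕ) (B : H.Subgraph) : Prop :=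
  B.verts.encard = k ∧ ∀ u ∈ B.verts, ∀ v ∈ B.verts, u ≠ v → B.Adj u v

/-- `A` is the `k`-sum of `A₁` and `A₂`: it is their union, and they overlap exactly in a complete
graph on `k` vertices, which is a proper subgraph of each of them. -/
def IsKSum {V : Type*} {H : SimpleGraph V} (k : ℕ) (A A₁ A₂ : H.Subgraph) : Prop :=
  A₁ ⊔ A₂ = A ∧ IsCompleteOn k (A₁ ⊓ A₂) ∧ A₁ ⊓ A₂ < A₁ ∧ A₁ ⊓ A₂ < A₂

/-- The `k`-sum components of `H`: the subgraphs that arise from `H` by undoing `k`-sums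
any number of times (possibly none). -/
inductive IsKSumComponent {V : Type*} (k : ℕ) (H : SimpleGraph V) : H.Subgraph → Prop
  | whole : IsKSumComponent k H ⊤
  | left {A A₁ A₂ : H.Subgraph} :
      IsKSumComponent k H A → IsKSum k A A₁ A₂ → IsKSumComponent k H A₁
  | right {A A₁ A₂ : H.Subgraph} :
      IsKSumComponent k H A → IsKSum k A A₁ A₂ → IsKSumComponent k H A₂

/-- `A` is a minimal `k`-sum component of `H` containing the pair `{v₁, v₂}`: it is minimal, for
the subgraph order, among the `k`-sum components of `H` that contain both vertices (and not
merely a component that cannot be decomposed further). -/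
def IsMinimalKSumComponentContaining {V : Type*} (k : ℕ) (H : SimpleGraph V) (v₁ v₂ : V)
    (A : H.Subgraph) : Prop :=
  Minimal (fun B : H.Subgraph => IsKSumComponent k H B ∧ v₁ ∈ B.verts ∧ v₂ ∈ B.verts) A

/-- The subgraph `A` is built from complete graphs on `k + 1` vertices by `k`-sums. -/
inductive IsKTreeSubgraph {V : Type*} (k : ℕ) (T : SimpleGraph V) : T.Subgraph → Prop
  | simplex {A : T.Subgraph} : IsCompleteOn (k + 1) A → IsKTreeSubgraph k T A
  | sum {A A₁ A₂ : T.Subgraph} : IsKTreeSubgraph k T A₁ → IsKTreeSubgraph k T A₂ →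
      IsKSum k A A₁ A₂ → IsKTreeSubgraph k T A

/-- A `k`-tree: a graph that is a `k`-sum of complete graphs on `k + 1` vertices. -/
def IsKTree {V : Type*} (k : ℕ) (T : SimpleGraph V) : Prop :=
  IsKTreeSubgraph k T ⊤

/-- A partial `k`-tree: a (finite) graph that is isomorphic to a (not necessarily induced)
subgraph of a `k`-tree. -/
def IsPartialKTree {V : Type*} (k : ℕ) (G : SimpleGraph V) : Prop :=
  ∃ (n : ℕ) (T : SimpleGraph (Fin n)), IsKTree k T ∧ G.IsContained T

/-! Write `ab` for the non-edge. Both directions turn on hinged `K₄`-minors, in which `a` and `b`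
lie in different branch sets and only the added pair joins those two sets.

Such a minor destroys convexity (`IsHingedK4.not_ordConnected`). Give length zero inside the branch
sets and place the other two sets at distance 2. The sets of `a` and `b` become apexes of right
isosceles triangles on that segment, so `ab` can have length 0 or 2 but not 1. A minimal component
is edge-inseparable, because an edge of `G` cutting off a part would give a smaller component
containing `ab`. For edge-inseparable graphs, `hasTwoTree_of_edgeInseparable` shows that a hinged
`K₄` is the only obstruction to lying in a 2-tree. If the graph minus `a`, `b` is disconnected, its
pieces are glued along `ab`. If it is connected, Menger's theorem gives either a hinged `K₄` or a
cut vertex `w`, and a triangle `abw` reduces the claim to the pairs `aw` and `bw`.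

Conversely, realizations `p` and `q` combine into `(√α p, √β q)` in four dimensions. This keeps the
lengths of `G` and interpolates the squared length of `ab`. A partial 2-tree can be flattened into
the plane with its edge lengths kept, which settles components that cannot be split; those among
them that are not minimal are handled by `hasTwoTree_of_not_minimal`.
`IsKSumComponent.exists_realization` then glues planar realizations along the hinges of the 2-sums.
-/

/-! ### Connected vertex sets and Menger's theorem for two paths -/

/-- The vertex set `C` is nonempty and induces a connected subgraph of `G`, phrased by closed sets:
a set that meets `C` and is closed under adjacency inside `C` contains `C`. -/
def ConnectedOn {V : Type*} (G : SimpleGraph V) (C : Set V) : Prop :=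
  C.Nonempty ∧ ∀ X : Set V, (∃ u ∈ C, u ∈ X) →
    (∀ u ∈ C, u ∈ X → ∀ v ∈ C, G.Adj u v → v ∈ X) → C ⊆ X

/-- Adjacency is symmetric, so the complement of a set closed inside `C` is closed as well. It
therefore suffices to test closed sets containing one root. -/
theorem ConnectedOn.of_root {V : Type*} {G : SimpleGraph V} {C : Set V} {a : V} (ha : a ∈ C)
    (h : ∀ X : Set V, a ∈ X → (∀ u ∈ C, u ∈ X → ∀ v ∈ C, G.Adj u v → v ∈ X) → C ⊆ X) :
    ConnectedOn G C := by
  refine ⟨⟨a, ha⟩, fun X ⟨u, hu, huX⟩ hX => ?_⟩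
  by_cases haX : a ∈ X
  · exact h X haX hX
  · refine absurd huX (h Xᶜ haX (fun u hu huX v hv huv hvX => ?_) hu)
    exact huX (hX v hv hvX u hu huv.symm)

theorem connectedOn_singleton {V : Type*} (G : SimpleGraph V) (a : V) : ConnectedOn G {a} :=
  .of_root rfl fun _ ha _ => Set.singleton_subset_iff.2 ha

theorem ConnectedOn.mono {V : Type*} {G K : SimpleGraph V} {C : Set V} (h : ConnectedOn G C)
    (hGK : G ≤ K) : ConnectedOn K C :=
  ⟨h.1, fun X hX hcl => h.2 X hX fun u hu huX v hv huv => hcl u hu huX v hv (hGK huv)⟩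

theorem ConnectedOn.union_of_adj {V : Type*} {G : SimpleGraph V} {C D : Set V} {x y : V}
    (hC : ConnectedOn G C) (hD : ConnectedOn G D) (hx : x ∈ C) (hy : y ∈ D) (hxy : G.Adj x y) :
    ConnectedOn G (C ∪ D) := by
  refine .of_root (Or.inl hx) fun X hX hcl => ?_
  have h1 : C ⊆ X := hC.2 X ⟨x, hx, hX⟩ fun u hu huX v hv => hcl u (.inl hu) huX v (.inl hv)
  have h2 : D ⊆ X := hD.2 X ⟨y, hy, hcl x (.inl hx) hX y (.inr hy) hxy⟩
    fun u hu huX v hv => hcl u (.inr hu) huX v (.inr hv)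
  exact Set.union_subset h1 h2

theorem ConnectedOn.union_of_mem {V : Type*} {G : SimpleGraph V} {C D : Set V} {x : V}
    (hC : ConnectedOn G C) (hD : ConnectedOn G D) (hx : x ∈ C) (hy : x ∈ D) :
    ConnectedOn G (C ∪ D) := by
  refine .of_root (Or.inl hx) fun X hX hcl => ?_
  have h1 : C ⊆ X := hC.2 X ⟨x, hx, hX⟩ fun u hu huX v hv => hcl u (.inl hu) huX v (.inl hv)
  have h2 : D ⊆ X := hD.2 X ⟨x, hy, hX⟩ fun u hu huX v hv => hcl u (.inr hu) huX v (.inr hv)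
  exact Set.union_subset h1 h2

/-- A connected set of the subgraph induced on `U` that meets `U` lies in `U`. -/
theorem ConnectedOn.subset_of_adj {V : Type*} {G : SimpleGraph V} {C U : Set V} {a : V}
    (hC : ConnectedOn G C) (hG : ∀ u v, G.Adj u v → v ∈ U) (ha : a ∈ C) (haU : a ∈ U) : C ⊆ U :=
  hC.2 U ⟨a, ha, haU⟩ fun _ _ _ _ _ h => hG _ _ h

/-- The vertex `w` separates `A` from `B` in `K`. -/
def VertexSeparates {V : Type*} (K : SimpleGraph V) (A B : Set V) (w : V) : Prop :=
  ∃ Y : Set V, w ∉ Y ∧ (∀ a ∈ A, a ≠ w → a ∈ Y) ∧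
    (∀ u ∈ Y, ∀ v, v ≠ w → K.Adj u v → v ∈ Y) ∧ ∀ b ∈ B, b ∉ Y

/-- The subgraph of `K` induced on `U`, as a graph on the same vertex type. -/
def restrictTo {V : Type*} (K : SimpleGraph V) (U : Set V) : SimpleGraph V where
  Adj u v := K.Adj u v ∧ u ∈ U ∧ v ∈ U
  symm := ⟨fun _ _ h => ⟨h.1.symm, h.2.2, h.2.1⟩⟩
  loopless := ⟨fun _ h => h.1.ne rfl⟩

theorem restrictTo_le {V : Type*} (K : SimpleGraph V) (U : Set V) : restrictTo K U ≤ K :=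
  fun _ _ h => h.1

/-- Menger's theorem for two paths: if no vertex separates `A` from `B`, there are two disjoint
connected sets that meet both. -/
theorem exists_disjoint_connectedOn {V : Type*} [Finite V] [Nonempty V] (K : SimpleGraph V)
    (A B : Set V) (h : ∀ w, ¬ VertexSeparates K A B w) :
    ∃ C D : Set V, ConnectedOn K C ∧ ConnectedOn K D ∧ Disjoint C D ∧
      (C ∩ A).Nonempty ∧ (C ∩ B).Nonempty ∧ (D ∩ A).Nonempty ∧ (D ∩ B).Nonempty := by
  -- Induction on the edge set: delete one edge and split the graph at a vertex that separates
  -- afterwards.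
  induction K using WellFoundedLT.induction generalizing A B with
  | ind K ih =>
  by_cases hE : ∃ x y, K.Adj x y
  swap
  -- Without edges, connected sets are singletons, so two common elements of `A` and `B` are needed.
  -- Having at most one would make it a separator.
  · have key : ∀ w, ∃ b ∈ B, b ∈ A ∧ b ≠ w := by
      intro w
      by_contra! hcon
      refine h w ⟨A \ {w}, by simp, fun a ha haw => ⟨ha, haw⟩,
        fun u _ v _ huv => absurd ⟨u, v, huv⟩ hE, fun b hb hbA => hbA.2 (hcon b hb hbA.1)⟩
    obtain ⟨c, hcB, hcA, -⟩ := key (Classical.arbitrary V)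
    obtain ⟨d, hdB, hdA, hdc⟩ := key c
    exact ⟨{c}, {d}, connectedOn_singleton _ _, connectedOn_singleton _ _,
      Set.disjoint_singleton.2 hdc.symm, ⟨c, rfl, hcA⟩, ⟨c, rfl, hcB⟩, ⟨d, rfl, hdA⟩,
      ⟨d, rfl, hdB⟩⟩
  obtain ⟨x₀, y₀, hxy₀⟩ := hE
  set K' := K.deleteEdges {s(x₀, y₀)} with hK'
  have hle : K' ≤ K := SimpleGraph.deleteEdges_le _
  have hlt : K' < K := by
    refine lt_of_le_of_ne hle fun he => ?_
    have : K'.Adj x₀ y₀ := he ▸ hxy₀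
    simp [hK'] at this
  by_cases hs : ∃ s, VertexSeparates K' A B s
  swap
  · obtain ⟨C, D, hC, hD, h'⟩ := ih K' hlt A B (not_exists.1 hs)
    exact ⟨C, D, hC.mono hle, hD.mono hle, h'⟩
  obtain ⟨s, Y, hsY, hAY, hcl, hBY⟩ := hs
  -- the deleted edge leaves `Y`
  obtain ⟨x, hxY, y, hys, hxy, hyY⟩ : ∃ x ∈ Y, ∃ y, y ≠ s ∧ K.Adj x y ∧ y ∉ Y := by
    by_contra! hcon
    exact h s ⟨Y, hsY, hAY, hcon, hBY⟩
  have hedge : ∀ u v, K.Adj u v → K'.Adj u v ∨ (u = x ∧ v = y) ∨ (u = y ∧ v = x) := by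
    have h1 : s(x, y) = s(x₀, y₀) := by
      by_contra hne
      exact hyY (hcl x hxY y hys (by rw [hK', SimpleGraph.deleteEdges_adj]; exact ⟨hxy, hne⟩))
    intro u v huv
    by_cases he : s(u, v) = s(x, y)
    · right; simpa using he
    · left
      rw [hK', SimpleGraph.deleteEdges_adj]
      exact ⟨huv, by rw [← h1]; exact he⟩
  have hxs : x ≠ s := fun h => hsY (h ▸ hxY)
  -- In `K`, every way out of `Y` passes through `s` or uses the edge `xy`. A separator of `A` from
  -- `{s, x}` on this side would thus separate `A` from `B`.
  have h1 : ∀ w, ¬ VertexSeparates (restrictTo K' (insert s Y)) A {s, x} w := by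
    rintro w ⟨Y₁, hw, hA₁, hcl₁, hB₁⟩
    have hs₁ := hB₁ s (by simp)
    have hx₁ := hB₁ x (by simp)
    refine h w ⟨Y₁ ∩ Y, fun hh => hw hh.1, fun a ha haw => ?_, ?_, fun b hb hh => hBY b hb hh.2⟩
    · have h2 := hA₁ a ha haw
      exact ⟨h2, hAY a ha fun hh => hs₁ (hh ▸ h2)⟩
    · rintro u ⟨hu₁, huY⟩ v hvw huv
      have h3 : K'.Adj u v := by
        rcases hedge u v huv with h3 | ⟨rfl, -⟩ | ⟨rfl, -⟩
        · exact h3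
        · exact absurd hu₁ hx₁
        · exact absurd huY hyY
      have h4 : v ∈ insert s Y := by
        by_cases hvs : v = s
        · exact .inl hvs
        · exact .inr (hcl u huY v hvs h3)
      have h5 : v ∈ Y₁ := hcl₁ u hu₁ v hvw ⟨h3, .inr huY, h4⟩
      exact ⟨h5, h4.resolve_left fun hh => hs₁ (hh ▸ h5)⟩
  -- Likewise on the other side, which is entered only through `s` or `y`.
  have h2 : ∀ w, ¬ VertexSeparates (restrictTo K' Yᶜ) {s, y} B w := by
    rintro w ⟨Y₂, hw, hA₂, hcl₂, hB₂⟩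
    refine h w ⟨(Y ∪ Y₂) \ {w}, by simp, fun a ha haw => ⟨?_, haw⟩, ?_, ?_⟩
    · by_cases has : a = s
      · exact .inr (hA₂ a (by simp [has]) haw)
      · exact .inl (hAY a ha has)
    · rintro u ⟨hu, huw⟩ v hvw huv
      refine ⟨?_, hvw⟩
      by_cases hvY : v ∈ Y
      · exact .inl hvY
      right
      by_cases huY : u ∈ Y
      · refine hA₂ v ?_ hvw
        rcases hedge u v huv with h3 | ⟨-, rfl⟩ | ⟨rfl, -⟩
        · by_contra hv
          exact hvY (hcl u huY v (fun hh => hv (by simp [hh])) h3)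
        · simp
        · exact absurd huY hyY
      · have hu₂ := hu.resolve_left huY
        rcases hedge u v huv with h3 | ⟨rfl, -⟩ | ⟨-, rfl⟩
        · exact hcl₂ u hu₂ v hvw ⟨h3, huY, hvY⟩
        · exact absurd hxY huY
        · exact absurd hxY hvY
    · rintro b hb ⟨hb' | hb', -⟩
      · exact hBY b hb hb'
      · exact hB₂ b hb hb'
  have hleft : ∃ C₁ C₂ : Set V, ConnectedOn K C₁ ∧ ConnectedOn K C₂ ∧ Disjoint C₁ C₂ ∧
      C₁ ⊆ insert s Y ∧ C₂ ⊆ insert s Y ∧ s ∈ C₁ ∧ x ∈ C₂ ∧ (C₁ ∩ A).Nonempty ∧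
      (C₂ ∩ A).Nonempty := by
    have hle1 := (restrictTo_le K' (insert s Y))
    obtain ⟨C, D, hC, hD, hCD, hCA, ⟨c, hcC, hc⟩, hDA, ⟨d, hdD, hd⟩⟩ :=
      ih _ (hle1.trans_lt hlt) _ _ h1
    have hCU := hC.subset_of_adj (U := insert s Y) (fun _ _ h => h.2.2) hcC
      (by rcases hc with rfl | rfl <;> simp [hxY])
    have hDU := hD.subset_of_adj (U := insert s Y) (fun _ _ h => h.2.2) hdD
      (by rcases hd with rfl | rfl <;> simp [hxY])
    have hne : c ≠ d := fun hh => Set.disjoint_left.1 hCD hcC (hh ▸ hdD)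
    rcases hc with rfl | rfl <;> rcases hd with rfl | rfl
    · exact absurd rfl hne
    · exact ⟨C, D, hC.mono (hle1.trans hle), hD.mono (hle1.trans hle), hCD, hCU, hDU, hcC, hdD,
        hCA, hDA⟩
    · exact ⟨D, C, hD.mono (hle1.trans hle), hC.mono (hle1.trans hle), hCD.symm, hDU, hCU, hdD,
        hcC, hDA, hCA⟩
    · exact absurd rfl hne
  have hright : ∃ D₁ D₂ : Set V, ConnectedOn K D₁ ∧ ConnectedOn K D₂ ∧ Disjoint D₁ D₂ ∧
      D₁ ⊆ Yᶜ ∧ D₂ ⊆ Yᶜ ∧ s ∈ D₁ ∧ y ∈ D₂ ∧ (D₁ ∩ B).Nonempty ∧ (D₂ ∩ B).Nonempty := by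
    have hle1 := (restrictTo_le K' Yᶜ)
    obtain ⟨C, D, hC, hD, hCD, ⟨c, hcC, hc⟩, hCA, ⟨d, hdD, hd⟩, hDA⟩ :=
      ih _ (hle1.trans_lt hlt) _ _ h2
    have hCU := hC.subset_of_adj (U := Yᶜ) (fun _ _ h => h.2.2) hcC
      (by rcases hc with rfl | rfl <;> assumption)
    have hDU := hD.subset_of_adj (U := Yᶜ) (fun _ _ h => h.2.2) hdD
      (by rcases hd with rfl | rfl <;> assumption)
    have hne : c ≠ d := fun hh => Set.disjoint_left.1 hCD hcC (hh ▸ hdD)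
    rcases hc with rfl | rfl <;> rcases hd with rfl | rfl
    · exact absurd rfl hne
    · exact ⟨C, D, hC.mono (hle1.trans hle), hD.mono (hle1.trans hle), hCD, hCU, hDU, hcC, hdD,
        hCA, hDA⟩
    · exact ⟨D, C, hD.mono (hle1.trans hle), hC.mono (hle1.trans hle), hCD.symm, hDU, hCU, hdD,
        hcC, hDA, hCA⟩
    · exact absurd rfl hne
  obtain ⟨C₁, C₂, hC₁, hC₂, hC, hC₁Y, hC₂Y, hsC, hxC, hC₁A, hC₂A⟩ := hleft
  obtain ⟨D₁, D₂, hD₁, hD₂, hD, hD₁Y, hD₂Y, hsD, hyD, hD₁B, hD₂B⟩ := hright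
  refine ⟨C₁ ∪ D₁, C₂ ∪ D₂, hC₁.union_of_mem hD₁ hsC hsD, hC₂.union_of_adj hD₂ hxC hyD hxy, ?_,
    hC₁A.mono (by gcongr; simp), hD₁B.mono (by gcongr; simp), hC₂A.mono (by gcongr; simp),
    hD₂B.mono (by gcongr; simp)⟩
  -- The two sides share only `s`, which lies in `C₁` and `D₁` but in neither `C₂` nor `D₂`.
  have hsC₂ := Set.disjoint_left.1 hC hsC
  have hsD₂ := Set.disjoint_left.1 hD hsD
  rw [Set.disjoint_left]
  rintro v (hv | hv) (hv' | hv')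
  · exact Set.disjoint_left.1 hC hv hv'
  · rcases hC₁Y hv with rfl | hvY
    · exact hsD₂ hv'
    · exact hD₂Y hv' hvY
  · rcases hC₂Y hv' with rfl | hvY
    · exact hsC₂ hv'
    · exact hD₁Y hv hvY
  · exact Set.disjoint_left.1 hD hv hv'

/-! ### Assembling 2-trees inside the complete graph -/

theorem IsKTreeSubgraph.exists_third {V : Type*} {T : SimpleGraph V} {B : T.Subgraph}
    (h : IsKTreeSubgraph 2 T B) (x y : V) : ∃ z ∈ B.verts, z ≠ x ∧ z ≠ y := by
  induction h with
  | @simplex A hA =>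
    by_contra! hcon
    have h1 : A.verts ⊆ {x, y} := fun z hz => by
      by_cases hzx : z = x
      · exact .inl hzx
      · exact .inr (hcon z hz hzx)
    have h2 := (Set.encard_le_encard h1).trans (Set.encard_insert_le _ _)
    rw [hA.1, Set.encard_singleton] at h2
    exact absurd h2 (by decide)
  | sum _ _ hs ih _ =>
    obtain ⟨z, hz, h⟩ := ih
    exact ⟨z, by rw [← hs.1]; exact .inl hz, h⟩

/-- A 2-tree always has a vertex besides `x` and `y`, so the hinge is automatically a proper
subgraph of both summands. -/
theorem IsKTreeSubgraph.sup {V : Type*} {T : SimpleGraph V} {B₁ B₂ : T.Subgraph} {x y : V}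
    (h₁ : IsKTreeSubgraph 2 T B₁) (h₂ : IsKTreeSubgraph 2 T B₂)
    (hv : B₁.verts ∩ B₂.verts = {x, y}) (hxy₁ : B₁.Adj x y) (hxy₂ : B₂.Adj x y) :
    IsKTreeSubgraph 2 T (B₁ ⊔ B₂) := by
  have hlt : ∀ B : T.Subgraph, IsKTreeSubgraph 2 T B → B₁ ⊓ B₂ ≤ B → B₁ ⊓ B₂ < B := by
    intro B hB hle
    refine lt_of_le_of_ne hle fun he => ?_
    obtain ⟨z, hz, hzx, hzy⟩ := hB.exists_third x y
    rw [← he, SimpleGraph.Subgraph.verts_inf, hv] at hz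
    rcases hz with rfl | rfl <;> contradiction
  refine .sum h₁ h₂ ⟨rfl, ⟨?_, ?_⟩, hlt _ h₁ inf_le_left, hlt _ h₂ inf_le_right⟩
  · rw [SimpleGraph.Subgraph.verts_inf, hv, Set.encard_pair hxy₁.ne]
    rfl
  · rw [SimpleGraph.Subgraph.verts_inf, hv]
    rintro u (rfl | rfl) v (rfl | rfl) huv
    · exact absurd rfl huv
    · exact ⟨hxy₁, hxy₂⟩
    · exact ⟨hxy₁.symm, hxy₂.symm⟩
    · exact absurd rfl huv

/-- The graph `G` restricted to `S`, together with the pair `ab`, is a single pair or lies in a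
`2`-tree on the vertex set `S`. -/
def HasTwoTree {V : Type*} (G : SimpleGraph V) (S : Set V) (a b : V) : Prop :=
  S = {a, b} ∨ ∃ B : (⊤ : SimpleGraph V).Subgraph, IsKTreeSubgraph 2 ⊤ B ∧ B.verts = S ∧
    B.Adj a b ∧ ∀ u ∈ S, ∀ v ∈ S, G.Adj u v → B.Adj u v

theorem HasTwoTree.symm {V : Type*} {G : SimpleGraph V} {S : Set V} {a b : V}
    (h : HasTwoTree G S a b) : HasTwoTree G S b a := by
  rcases h with rfl | ⟨B, hB, hv, hab, h⟩
  · exact .inl (Set.pair_comm _ _)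
  · exact .inr ⟨B, hB, hv, hab.symm, h⟩

theorem exists_triangle {V : Type*} {a b c : V} (hab : a ≠ b) (hac : a ≠ c) (hbc : b ≠ c) :
    ∃ B : (⊤ : SimpleGraph V).Subgraph, IsKTreeSubgraph 2 ⊤ B ∧ B.verts = {a, b, c} ∧
      ∀ u ∈ B.verts, ∀ v ∈ B.verts, u ≠ v → B.Adj u v := by
  have h : ∀ u ∈ ({a, b, c} : Set V), ∀ v ∈ ({a, b, c} : Set V), u ≠ v →
      ((⊤ : (⊤ : SimpleGraph V).Subgraph).induce {a, b, c}).Adj u v :=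
    fun u hu v hv huv => ⟨hu, hv, huv⟩
  refine ⟨(⊤ : (⊤ : SimpleGraph V).Subgraph).induce {a, b, c}, .simplex ⟨?_, h⟩, rfl, h⟩
  rw [SimpleGraph.Subgraph.induce_verts, Set.encard_insert_of_notMem (by simp [hab, hac]),
    Set.encard_pair hbc]
  rfl

theorem HasTwoTree.extend {V : Type*} {G : SimpleGraph V} {S : Set V} {x y : V}
    {B : (⊤ : SimpleGraph V).Subgraph} (hB : IsKTreeSubgraph 2 ⊤ B) (hxy : B.Adj x y)
    (h : HasTwoTree G S x y) (hS : B.verts ∩ S = {x, y}) :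
    ∃ B' : (⊤ : SimpleGraph V).Subgraph, IsKTreeSubgraph 2 ⊤ B' ∧ B'.verts = B.verts ∪ S ∧
      B ≤ B' ∧ ∀ u ∈ S, ∀ v ∈ S, G.Adj u v → B'.Adj u v := by
  rcases h with rfl | ⟨C, hC, rfl, hCxy, h⟩
  · refine ⟨B, hB, ?_, le_rfl, ?_⟩
    · rw [Set.union_eq_left.2]
      rw [← hS]; exact Set.inter_subset_left
    · rintro u (rfl | rfl) v (rfl | rfl) huv
      · exact absurd rfl huv.ne
      · exact hxy
      · exact hxy.symm
      · exact absurd rfl huv.ne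
  · exact ⟨B ⊔ C, hB.sup hC hS hxy hCxy, rfl, le_sup_left,
      fun u hu v hv huv => .inr (h u hu v hv huv)⟩

/-- Parallel composition: the two 2-trees are summed along their common edge `ab`. -/
theorem HasTwoTree.union {V : Type*} {G : SimpleGraph V} {S₁ S₂ : Set V} {a b : V}
    (h₁ : HasTwoTree G S₁ a b) (h₂ : HasTwoTree G S₂ a b) (hS : S₁ ∩ S₂ = {a, b})
    (hG : ∀ u ∈ S₁, ∀ v ∈ S₂, G.Adj u v → (u ∈ S₂ ∨ v ∈ S₁)) :
    HasTwoTree G (S₁ ∪ S₂) a b := by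
  rcases h₁ with rfl | ⟨B, hB, rfl, hab, h⟩
  · rwa [Set.union_eq_right.2]
    rw [← hS]; exact Set.inter_subset_right
  · obtain ⟨B', hB', hv, hle, h'⟩ := h₂.extend hB hab hS
    have key : ∀ u ∈ B.verts, ∀ v ∈ S₂, G.Adj u v → B'.Adj u v := by
      intro u hu v hv huv
      rcases hG u hu v hv huv with h1 | h1
      · exact h' u h1 v hv huv
      · exact hle.2 (h u hu v h1 huv)
    refine .inr ⟨B', hB', hv, hle.2 hab, ?_⟩
    rintro u (hu | hu) v (hv | hv) huv
    · exact hle.2 (h u hu v hv huv)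
    · exact key u hu v hv huv
    · exact (key v hv u hu huv.symm).symm
    · exact h' u hu v hv huv

/-- Series composition: a triangle `abw` receives the two 2-trees on its sides `aw` and `bw`. -/
theorem HasTwoTree.triangle {V : Type*} {G : SimpleGraph V} {S₁ S₂ : Set V} {a b w : V}
    (hab : a ≠ b) (haw : a ≠ w) (hbw : b ≠ w)
    (h₁ : HasTwoTree G S₁ a w) (h₂ : HasTwoTree G S₂ b w) (hS : S₁ ∩ S₂ = {w})
    (ha : a ∈ S₁) (hb : b ∈ S₂)
    (hG : ∀ u ∈ S₁, ∀ v ∈ S₂, G.Adj u v → u = w ∨ v = w) : HasTwoTree G (S₁ ∪ S₂) a b := by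
  have hmem : ∀ v, v ∈ S₁ → v ∈ S₂ → v = w := fun v h h' => by
    have : v ∈ S₁ ∩ S₂ := ⟨h, h'⟩
    rwa [hS] at this
  have hw : w ∈ S₁ ∩ S₂ := by rw [hS]; rfl
  obtain ⟨T, hT, hTv, hTa⟩ := exists_triangle hab haw hbw
  have haT : a ∈ T.verts := by simp [hTv]
  have hbT : b ∈ T.verts := by simp [hTv]
  have hwT : w ∈ T.verts := by simp [hTv]
  obtain ⟨B, hB, hBv, hBT, hBG⟩ := h₁.extend hT (hTa a haT w hwT haw) (by
    ext v
    rw [hTv]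
    constructor
    · rintro ⟨rfl | rfl | rfl, hv⟩
      · simp
      · exact absurd (hmem _ hv hb) hbw
      · simp
    · rintro (rfl | rfl)
      · simp [ha]
      · simp [hw.1])
  obtain ⟨C, hC, hCv, hCB, hCG⟩ := h₂.extend hB (hBT.2 (hTa b hbT w hwT hbw)) (by
    ext v
    rw [hBv, hTv]
    constructor
    · rintro ⟨(rfl | rfl | rfl) | hv, hv'⟩
      · exact absurd (hmem _ ha hv') haw
      · simp
      · simp
      · simp [hmem _ hv hv']
    · rintro (rfl | rfl)
      · simp [hb]
      · simp [hw.2])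
  have key : ∀ u ∈ S₁, ∀ v ∈ S₂, G.Adj u v → C.Adj u v := by
    intro u hu v hv huv
    rcases hG u hu v hv huv with rfl | rfl
    · exact hCG u hw.2 v hv huv
    · exact hCB.2 (hBG u hu v hw.1 huv)
  refine .inr ⟨C, hC, ?_, hCB.2 (hBT.2 (hTa a haT b hbT hab)), ?_⟩
  · rw [hCv, hBv, hTv]
    ext v
    constructor
    · rintro (((rfl | rfl | rfl) | hv) | hv)
      · exact .inl ha
      · exact .inr hb
      · exact .inl hw.1
      · exact .inl hv
      · exact .inr hv
    · rintro (hv | hv)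
      · exact .inl (.inr hv)
      · exact .inr hv
  · rintro u (hu | hu) v (hv | hv) huv
    · exact hCB.2 (hBG u hu v hv huv)
    · exact key u hu v hv huv
    · exact (key v hv u hu huv.symm).symm
    · exact hCG u hu v hv huv

theorem hasTwoTree_of_three {V : Type*} (G : SimpleGraph V) {a b c : V} (hab : a ≠ b)
    (hac : a ≠ c) (hbc : b ≠ c) : HasTwoTree G {a, b, c} a b := by
  obtain ⟨B, hB, hv, h⟩ := exists_triangle hab hac hbc
  refine .inr ⟨B, hB, hv, h a (by simp [hv]) b (by simp [hv]) hab, fun u hu v hv' huv => ?_⟩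
  exact h u (by rwa [hv]) v (by rwa [hv]) huv.ne

/-- Two disjoint pairs `ab`, `xy` with no edge of `G` between them. -/
theorem hasTwoTree_of_four {V : Type*} {G : SimpleGraph V} {a b x y : V} (hab : a ≠ b)
    (hax : a ≠ x) (hay : a ≠ y) (hbx : b ≠ x) (hby : b ≠ y) (hxy : x ≠ y)
    (hGa : ¬ G.Adj a b) (hay' : ¬ G.Adj a y) :
    HasTwoTree G {a, b, x, y} a b := by
  -- The triangles `abx` and `bxy`, glued along `bx`, cover every pair except `ay`.
  have h := HasTwoTree.triangle (G := G) (S₁ := {a, x}) (S₂ := {b, x, y}) hab hax hbx (.inl rfl)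
    (hasTwoTree_of_three G hbx hby hxy) (by
      ext v
      simp only [Set.mem_inter_iff, Set.mem_insert_iff, Set.mem_singleton_iff]
      constructor
      · rintro ⟨rfl | rfl, h⟩
        · rcases h with h | h | h <;> contradiction
        · rfl
      · rintro rfl; simp) (by simp) (by simp) (by
      rintro u (rfl | rfl) v (rfl | rfl | rfl) huv
      · contradiction
      · exact .inr rfl
      · contradiction
      · exact .inl rfl
      · exact .inl rfl
      · exact .inl rfl)
  convert h using 1
  ext v
  simp only [Set.mem_union, Set.mem_insert_iff, Set.mem_singleton_iff]
  tauto

/-! ### Hinged `K₄`-minors as the obstruction for edge-inseparable graphs -/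

/-- Some edge of `G` joins `A` to `B`. -/
def Touches {V : Type*} (G : SimpleGraph V) (A B : Set V) : Prop :=
  ∃ u ∈ A, ∃ v ∈ B, G.Adj u v

theorem Touches.mono {V : Type*} {G : SimpleGraph V} {A B A' B' : Set V} (h : Touches G A B)
    (hA : A ⊆ A') (hB : B ⊆ B') : Touches G A' B' := by
  obtain ⟨u, hu, v, hv, huv⟩ := h
  exact ⟨u, hA hu, v, hB hv, huv⟩

theorem Touches.symm {V : Type*} {G : SimpleGraph V} {A B : Set V} (h : Touches G A B) :
    Touches G B A := by
  obtain ⟨u, hu, v, hv, huv⟩ := h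
  exact ⟨v, hv, u, hu, huv.symm⟩

/-- `A`, `B`, `C`, `D` are the branch sets of a `K₄`-minor of `G` plus the pair `ab`, in which the
edge between `A` and `B` comes from the pair `ab` alone. -/
structure IsHingedK4 {V : Type*} (G : SimpleGraph V) (a b : V) (A B C D : Set V) : Prop where
  mem_left : a ∈ A
  mem_right : b ∈ B
  connA : ConnectedOn G A
  connB : ConnectedOn G B
  connC : ConnectedOn G C
  connD : ConnectedOn G D
  disjAB : Disjoint A B
  disjAC : Disjoint A C
  disjAD : Disjoint A D
  disjBC : Disjoint B C
  disjBD : Disjoint B D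
  disjCD : Disjoint C D
  not_touches : ¬ Touches G A B
  touchAC : Touches G A C
  touchAD : Touches G A D
  touchBC : Touches G B C
  touchBD : Touches G B D
  touchCD : Touches G C D

theorem IsHingedK4.swap {V : Type*} {G : SimpleGraph V} {a b : V} {A B C D : Set V}
    (h : IsHingedK4 G a b A B C D) : IsHingedK4 G b a B A C D :=
  ⟨h.mem_right, h.mem_left, h.connB, h.connA, h.connC, h.connD, h.disjAB.symm, h.disjBC, h.disjBD,
    h.disjAC, h.disjAD, h.disjCD, fun hh => h.not_touches hh.symm, h.touchBC, h.touchBD, h.touchAC,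
    h.touchAD, h.touchCD⟩

/-- `S` contains the branch sets of a `K₄`-minor hinged at the pair `ab`. -/
def HasHingedK4 {V : Type*} (G : SimpleGraph V) (S : Set V) (a b : V) : Prop :=
  ∃ A B C D : Set V, IsHingedK4 G a b A B C D ∧ A ⊆ S ∧ B ⊆ S ∧ C ⊆ S ∧ D ⊆ S

theorem HasHingedK4.mono {V : Type*} {G : SimpleGraph V} {S S' : Set V} {a b : V}
    (h : HasHingedK4 G S a b) (hS : S ⊆ S') : HasHingedK4 G S' a b := by
  obtain ⟨A, B, C, D, h, hA, hB, hC, hD⟩ := h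
  exact ⟨A, B, C, D, h, hA.trans hS, hB.trans hS, hC.trans hS, hD.trans hS⟩

theorem HasHingedK4.symm {V : Type*} {G : SimpleGraph V} {S : Set V} {a b : V}
    (h : HasHingedK4 G S a b) : HasHingedK4 G S b a := by
  obtain ⟨A, B, C, D, h, hA, hB, hC, hD⟩ := h
  exact ⟨B, A, C, D, h.swap, hB, hA, hC, hD⟩

/-- No edge of `G` inside `S` separates a part of `S` from the pair `ab`. -/
def EdgeInseparable {V : Type*} (G : SimpleGraph V) (S : Set V) (a b : V) : Prop :=
  ∀ x ∈ S, ∀ y ∈ S, G.Adj x y → ∀ T ⊆ S, a ∉ T → b ∉ T → x ∉ T → y ∉ T →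
    (∀ u ∈ T, ∀ v ∈ S, G.Adj u v → v ∈ T ∨ v = x ∨ v = y) → T = ∅

theorem EdgeInseparable.symm {V : Type*} {G : SimpleGraph V} {S : Set V} {a b : V}
    (h : EdgeInseparable G S a b) : EdgeInseparable G S b a :=
  fun x hx y hy hxy T hT hb ha => h x hx y hy hxy T hT ha hb

/-- Inseparability passes to a part that only meets the rest in two vertices. -/
theorem EdgeInseparable.part {V : Type*} {G : SimpleGraph V} {S S' : Set V} {a b a' b' : V}
    (h : EdgeInseparable G S a b) (hS : S' ⊆ S) (ha : a ∈ S' → a = a' ∨ a = b')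
    (hb : b ∈ S' → b = a' ∨ b = b')
    (hcl : ∀ u ∈ S', u ≠ a' → u ≠ b' → ∀ v ∈ S, G.Adj u v → v ∈ S') :
    EdgeInseparable G S' a' b' := by
  intro x hx y hy hxy T hT ha' hb' hxT hyT hTcl
  refine h x (hS hx) y (hS hy) hxy T (hT.trans hS) ?_ ?_ hxT hyT fun u hu v hv huv => ?_
  · intro hh
    rcases ha (hT hh) with rfl | rfl <;> contradiction
  · intro hh
    rcases hb (hT hh) with rfl | rfl <;> contradiction
  · refine hTcl u hu v (hcl u (hT hu) ?_ ?_ v hv huv) huv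
    · rintro rfl; contradiction
    · rintro rfl; contradiction

/-- In a connected set `R`, two disjoint connected sets can be enlarged so that they touch. -/
theorem ConnectedOn.exists_touching {V : Type*} {G : SimpleGraph V} {R C D : Set V}
    (hR : ConnectedOn G R) (hC : ConnectedOn G C) (hD : D.Nonempty) (hCR : C ⊆ R) (hDR : D ⊆ R)
    (hCD : Disjoint C D) :
    ∃ C', C ⊆ C' ∧ C' ⊆ R ∧ ConnectedOn G C' ∧ Disjoint C' D ∧ Touches G C' D := by
  obtain ⟨c, hc⟩ := hC.1
  -- `C'` is the part of `R \ D` reachable from `c`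
  set C' : Set V := {v | ∀ X : Set V, c ∈ X →
    (∀ u ∈ X, ∀ v ∈ R, v ∉ D → G.Adj u v → v ∈ X) → v ∈ X} with hC'
  have hcC' : c ∈ C' := fun X hX _ => hX
  have hstep : ∀ u ∈ C', ∀ v ∈ R, v ∉ D → G.Adj u v → v ∈ C' :=
    fun u hu v hv hvD huv X hX hcl => hcl u (hu X hX hcl) v hv hvD huv
  have hsub : C' ⊆ R \ D := fun v hv =>
    hv (R \ D) ⟨hCR hc, Set.disjoint_left.1 hCD hc⟩ fun u _ v hv hvD _ => ⟨hv, hvD⟩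
  have hconn : ConnectedOn G C' := by
    refine .of_root hcC' fun X hX hcl v hv => ?_
    exact (hv (X ∩ C') ⟨hX, hcC'⟩ fun u hu v hv hvD huv =>
      have h := hstep u hu.2 v hv hvD huv
      ⟨hcl u hu.2 hu.1 v h huv, h⟩).1
  refine ⟨C', ?_, hsub.trans Set.sdiff_subset, hconn,
    Set.disjoint_left.2 fun v hv => (hsub hv).2, ?_⟩
  · exact hC.2 C' ⟨c, hc, hcC'⟩ fun u _ huC v hv huv =>
      hstep u huC v (hCR hv) (Set.disjoint_left.1 hCD hv) huv
  · by_contra hcon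
    obtain ⟨d, hd⟩ := hD
    have := hR.2 C' ⟨c, hCR hc, hcC'⟩ fun u _ huC v hv huv => by
      refine hstep u huC v hv (fun hvD => ?_) huv
      exact hcon ⟨u, huC, v, hvD, huv⟩
    exact (hsub (this (hDR hd))).2 hd

/-- Menger's theorem gives two disjoint connected sets in `R`, each meeting the neighbours of `a`
and of `b`. After one is enlarged until they touch, `{a}` and `{b}` complete the minor. -/
theorem hasHingedK4_of_not_separates {V : Type*} [Finite V] {G : SimpleGraph V} {R : Set V}
    {a b : V} (hab : a ≠ b) (hGab : ¬ G.Adj a b) (haR : a ∉ R) (hbR : b ∉ R)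
    (hR : ConnectedOn G R)
    (h : ∀ w, ¬ VertexSeparates (restrictTo G R) {u ∈ R | G.Adj a u} {u ∈ R | G.Adj b u} w) :
    HasHingedK4 G (insert a (insert b R)) a b := by
  have : Nonempty V := ⟨a⟩
  obtain ⟨C, D, hC, hD, hCD, ⟨c, hcC, hcR, hac⟩, ⟨c', hcC', -, hbc⟩, ⟨d, hdD, hdR, had⟩,
    ⟨d', hdD', -, hbd⟩⟩ := exists_disjoint_connectedOn _ _ _ h
  have hCR := hC.subset_of_adj (U := R) (fun _ _ h => h.2.2) hcC hcR
  have hDR := hD.subset_of_adj (U := R) (fun _ _ h => h.2.2) hdD hdR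
  have hC := hC.mono (restrictTo_le G R)
  have hD := hD.mono (restrictTo_le G R)
  obtain ⟨C', hCC', hC'R, hC', hC'D, ht⟩ := hR.exists_touching hC ⟨d, hdD⟩ hCR hDR hCD
  have hdisj : ∀ {v : V} {E : Set V}, v ∉ R → E ⊆ R → Disjoint {v} E := fun hv hE =>
    Set.disjoint_singleton_left.2 fun h => hv (hE h)
  refine ⟨{a}, {b}, C', D, ⟨rfl, rfl, connectedOn_singleton _ _, connectedOn_singleton _ _, hC',
    hD, Set.disjoint_singleton.2 hab, hdisj haR hC'R, hdisj haR hDR, hdisj hbR hC'R,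
    hdisj hbR hDR, hC'D, ?_, ⟨a, rfl, c, hCC' hcC, hac⟩, ⟨a, rfl, d, hdD, had⟩,
    ⟨b, rfl, c', hCC' hcC', hbc⟩, ⟨b, rfl, d', hdD', hbd⟩, ht⟩, by simp, by simp, ?_, ?_⟩
  · rintro ⟨u, rfl, v, rfl, huv⟩
    exact hGab huv
  · exact hC'R.trans fun v hv => .inr (.inr hv)
  · exact hDR.trans fun v hv => .inr (.inr hv)

/-- The side `P` of a cut vertex `w` between `a` and `b`. -/
theorem hasTwoTree_side {V : Type*} {G : SimpleGraph V} {P Q : Set V} {a b w : V}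
    (ih : ¬ G.Adj a w → EdgeInseparable G (insert a (insert w P)) a w →
      ¬ HasHingedK4 G (insert a (insert w P)) a w → HasTwoTree G (insert a (insert w P)) a w)
    (hab : a ≠ b) (haw : a ≠ w) (hbw : b ≠ w) (haP : a ∉ P) (haQ : a ∉ Q) (hbP : b ∉ P)
    (hwP : w ∉ P) (hPQ : Disjoint P Q) (hGab : ¬ G.Adj a b)
    (hPQ' : ¬ Touches G P Q) (hbP' : ∀ u ∈ P, ¬ G.Adj b u) (haQ' : ∀ u ∈ Q, ¬ G.Adj a u)
    (hR : ConnectedOn G (insert w (P ∪ Q))) (hb : ∃ u ∈ insert w Q, G.Adj b u)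
    (hE : EdgeInseparable G (insert a (insert b (insert w (P ∪ Q)))) a b)
    (hK : ¬ HasHingedK4 G (insert a (insert b (insert w (P ∪ Q)))) a b) :
    HasTwoTree G (insert a (insert w P)) a w := by
  have hPcl : ∀ u ∈ P, ∀ v ∈ insert a (insert b (insert w (P ∪ Q))), G.Adj u v →
      v ∈ P ∨ v = a ∨ v = w := by
    rintro u hu v (rfl | rfl | rfl | hv | hv) huv
    · simp
    · exact absurd huv.symm (hbP' u hu)
    · simp
    · exact .inl hv
    · exact absurd ⟨u, hu, v, hv, huv⟩ hPQ'
  -- If `aw` is an edge of `G`, it cuts `P` off from `ab`, so inseparability forces `P` to be empty.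
  by_cases hGaw : G.Adj a w
  · left
    rw [hE a (by simp) w (by simp) hGaw P (fun v hv => by simp [hv]) haP hbP haP hwP hPcl]
    simp
  have hsub : insert a (insert w P) ⊆ insert a (insert b (insert w (P ∪ Q))) := by
    rintro v (rfl | rfl | hv)
    · simp
    · simp
    · simp [hv]
  refine ih hGaw (hE.part hsub (fun _ => .inl rfl) ?_ ?_) ?_
  · rintro (h | h | h)
    · exact absurd h hab.symm
    · exact .inr h
    · exact absurd h hbP
  · rintro u (rfl | rfl | hu) hua huw v hv huv
    · contradiction
    · contradiction
    · rcases hPcl u hu v hv huv with h | rfl | rfl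
      · simp [h]
      · simp
      · simp
  -- A minor hinged at `aw` becomes one hinged at `ab` when the branch set of `w` absorbs `Q` and
  -- `b`. No edge to the branch set of `a` arises, since `a` and `P` have no neighbours in `Q ∪
  -- {b}`.
  · rintro ⟨A, B, C, D, h, hA, hB, hC, hD⟩
    refine hK ?_
    -- Within `R`, the part `P` meets the rest only through `w`, so removing it keeps the rest
    -- connected.
    have hZ : ConnectedOn G (insert w Q) := by
      refine .of_root (.inl rfl) fun X hX hcl => ?_
      have := hR.2 (X ∪ P) ⟨w, .inl rfl, .inl hX⟩ fun u hu huX v hv huv => by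
        by_cases hvP : v ∈ P
        · exact .inr hvP
        left
        have hv' : v ∈ insert w Q := by
          rcases hv with h | h | h
          · exact .inl h
          · exact absurd h hvP
          · exact .inr h
        rcases huX with huX | huP
        · by_cases huP : u ∈ P
          · rcases hv' with rfl | hvQ
            · exact hX
            · exact absurd ⟨u, huP, v, hvQ, huv⟩ hPQ'
          · refine hcl u ?_ huX v hv' huv
            rcases hu with h | h | h
            · exact .inl h
            · exact absurd h huP
            · exact .inr h
        · rcases hv' with rfl | hvQ
          · exact hX
          · exact absurd ⟨u, huP, v, hvQ, huv⟩ hPQ'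
      rintro v (rfl | hv)
      · exact hX
      · exact (this (.inr (.inr hv))).resolve_right fun hvP => Set.disjoint_left.1 hPQ hvP hv
    obtain ⟨b', hb', hbb'⟩ := hb
    have hZ' : ConnectedOn G (insert w Q ∪ {b}) :=
      hZ.union_of_adj (connectedOn_singleton G b) hb' rfl hbb'.symm
    have hB' := h.connB.union_of_mem hZ' h.mem_right (.inl (.inl rfl))
    have hZS : ∀ E : Set V, E ⊆ insert a (insert w P) → Disjoint B E →
        Disjoint (B ∪ (insert w Q ∪ {b})) E := by
      intro E hES hBE
      rw [Set.disjoint_union_left]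
      refine ⟨hBE, Set.disjoint_left.2 ?_⟩
      rintro v ((rfl | hv) | rfl) hvE
      · exact Set.disjoint_left.1 hBE h.mem_right hvE
      · rcases hES hvE with rfl | rfl | hv'
        · exact haQ hv
        · exact Set.disjoint_left.1 hBE h.mem_right hvE
        · exact Set.disjoint_left.1 hPQ hv' hv
      · rcases hES hvE with rfl | rfl | hv'
        · exact hab rfl
        · exact hbw rfl
        · exact hbP hv'
    refine ⟨A, B ∪ (insert w Q ∪ {b}), C, D, ⟨h.mem_left, .inr (.inr rfl), h.connA, hB', h.connC,
      h.connD, (hZS A hA h.disjAB.symm).symm, h.disjAC, h.disjAD, hZS C hC h.disjBC,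
      hZS D hD h.disjBD, h.disjCD, ?_, h.touchAC, h.touchAD,
      h.touchBC.mono Set.subset_union_left subset_rfl,
      h.touchBD.mono Set.subset_union_left subset_rfl, h.touchCD⟩, hA.trans hsub, ?_,
      hC.trans hsub, hD.trans hsub⟩
    · rintro ⟨u, hu, v, hv | hv, huv⟩
      · exact h.not_touches ⟨u, hu, v, hv, huv⟩
      · have huw : u ≠ w := fun hh => Set.disjoint_left.1 h.disjAB hu (hh ▸ h.mem_right)
        rcases hv with (rfl | hv) | rfl
        · exact h.not_touches ⟨u, hu, _, h.mem_right, huv⟩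
        · rcases hA hu with rfl | rfl | hu
          · exact haQ' v hv huv
          · exact huw rfl
          · exact hPQ' ⟨u, hu, v, hv, huv⟩
        · rcases hA hu with rfl | rfl | hu
          · exact hGab huv
          · exact huw rfl
          · exact hbP' u hu huv.symm
    · rintro v (hv | (rfl | hv) | rfl)
      · exact hsub (hB hv)
      · simp
      · simp [hv]
      · simp

/-- Small case: if the rest `R` is connected and one end of the pair has no neighbour in `R`, then
`R` has at most two vertices. -/
theorem hasTwoTree_of_pendant {V : Type*} {G : SimpleGraph V} {R : Set V} {a b : V}
    (hab : a ≠ b) (hGab : ¬ G.Adj a b) (haR : a ∉ R) (hbR : b ∉ R) (hR : ConnectedOn G R)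
    (hE : EdgeInseparable G (insert a (insert b R)) a b) (ha : ∀ u ∈ R, ¬ G.Adj a u) :
    HasTwoTree G (insert a (insert b R)) a b := by
  have hne : ∀ r ∈ R, a ≠ r ∧ b ≠ r := fun r hr =>
    ⟨fun h => haR (h ▸ hr), fun h => hbR (h ▸ hr)⟩
  have hone : ∀ r ∈ R, R \ {r} = ∅ → HasTwoTree G (insert a (insert b R)) a b := by
    intro r hr h
    have : R = {r} := Set.Subset.antisymm (Set.sdiff_eq_empty.1 h) (Set.singleton_subset_iff.2 hr)
    rw [this]
    exact hasTwoTree_of_three G hab (hne r hr).1 (hne r hr).2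
  by_cases hb : ∃ y ∈ R, G.Adj b y
  · obtain ⟨y, hy, hby⟩ := hb
    -- The edge `by` would cut off the rest of `R`, since `a` has no neighbours there.
    refine hone y hy (hE b (by simp) y (by simp [hy]) hby _ (fun v hv => by simp [hv.1])
      (fun h => haR h.1) (fun h => hbR h.1) (fun h => hbR h.1) (fun h => h.2 rfl) ?_)
    rintro u ⟨hu, -⟩ v (rfl | rfl | hv) huv
    · exact absurd huv.symm (ha u hu)
    · simp
    · by_cases hvy : v = y
      · simp [hvy]
      · exact .inl ⟨hv, hvy⟩
  · push Not at hb
    obtain ⟨x, hx⟩ := hR.1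
    by_cases hy : ∃ y ∈ R, G.Adj x y
    · obtain ⟨y, hy, hxy⟩ := hy
      have hT := hE x (by simp [hx]) y (by simp [hy]) hxy (R \ {x, y}) (fun v hv => by simp [hv.1])
        (fun h => haR h.1) (fun h => hbR h.1) (fun h => h.2 (by simp)) (fun h => h.2 (by simp)) (by
          rintro u ⟨hu, -⟩ v (rfl | rfl | hv) huv
          · exact absurd huv.symm (ha u hu)
          · exact absurd huv.symm (hb u hu)
          · by_cases hvx : v = x
            · simp [hvx]
            by_cases hvy : v = y
            · simp [hvy]
            · exact .inl ⟨hv, by simp [hvx, hvy]⟩)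
      have : R = {x, y} := Set.Subset.antisymm (Set.sdiff_eq_empty.1 hT)
        (by rintro v (rfl | rfl) <;> assumption)
      rw [this]
      exact hasTwoTree_of_four hab (hne x hx).1 (hne y hy).1 (hne x hx).2 (hne y hy).2 hxy.ne hGab
        (ha y hy)
    · refine hone x hx (Set.sdiff_eq_empty.2 (hR.2 {x} ⟨x, hx, rfl⟩ ?_))
      rintro u - rfl v hv huv
      exact absurd ⟨v, hv, huv⟩ hy

theorem insert_insert_diff {V : Type*} {S : Set V} {a b : V} (ha : a ∈ S) (hb : b ∈ S) :
    insert a (insert b (S \ {a, b})) = S := by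
  ext v
  simp only [Set.mem_insert_iff, Set.mem_sdiff, Set.mem_singleton_iff]
  constructor
  · rintro (rfl | rfl | h)
    · exact ha
    · exact hb
    · exact h.1
  · intro h; tauto

/-- Without a `K₄`-minor hinged at `ab`, an edge-inseparable graph plus the pair `ab` lies in a
`2`-tree. -/
theorem hasTwoTree_of_edgeInseparable {V : Type*} [Finite V] {G : SimpleGraph V} {S : Set V}
    {a b : V} (hab : a ≠ b) (ha : a ∈ S) (hb : b ∈ S) (hGab : ¬ G.Adj a b)
    (hE : EdgeInseparable G S a b) (hK : ¬ HasHingedK4 G S a b) : HasTwoTree G S a b := by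
  induction hn : S.ncard using Nat.strong_induction_on generalizing S a b with
  | _ n ih =>
  have ih' : ∀ S' : Set V, S' ⊂ S → ∀ a' b', a' ≠ b' → a' ∈ S' → b' ∈ S' → ¬ G.Adj a' b' →
      EdgeInseparable G S' a' b' → ¬ HasHingedK4 G S' a' b' → HasTwoTree G S' a' b' :=
    fun S' hS' a' b' h1 h2 h3 h4 h5 h6 =>
      ih _ (hn ▸ Set.ncard_lt_ncard hS' S.toFinite) h1 h2 h3 h4 h5 h6 rfl
  clear ih
  obtain ⟨R, hRS, haR, hbR⟩ : ∃ R, S = insert a (insert b R) ∧ a ∉ R ∧ b ∉ R :=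
    ⟨S \ {a, b}, (insert_insert_diff ha hb).symm, by simp, by simp⟩
  subst hRS
  rcases R.eq_empty_or_nonempty with rfl | hRne
  · left; simp
  -- If `R` is disconnected, two unions of its pieces are treated separately, each together with
  -- `ab`, and composed in parallel.
  by_cases hR : ConnectedOn G R
  swap
  · obtain ⟨X, ⟨t, htR, htX⟩, hcl, hX⟩ : ∃ X : Set V, (∃ u ∈ R, u ∈ X) ∧
        (∀ u ∈ R, u ∈ X → ∀ v ∈ R, G.Adj u v → v ∈ X) ∧ ¬ R ⊆ X := by
      by_contra! hcon
      exact hR ⟨hRne, fun X h h' => hcon X h h'⟩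
    obtain ⟨z, hzR, hzX⟩ := Set.not_subset.1 hX
    have hpart : ∀ T ⊆ R, (∃ z ∈ R, z ∉ T) → (∀ u ∈ T, ∀ v ∈ R, G.Adj u v → v ∈ T) →
        HasTwoTree G (insert a (insert b T)) a b := by
      intro T hT ⟨z, hzR, hzT⟩ hcl
      have hsub : insert a (insert b T) ⊆ insert a (insert b R) := by gcongr
      refine ih' _ ⟨hsub, fun h => ?_⟩ a b hab (by simp) (by simp) hGab
        (hE.part hsub (fun _ => .inl rfl) (fun _ => .inr rfl) ?_) (fun h => hK (h.mono hsub))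
      · rcases h (.inr (.inr hzR)) with rfl | rfl | h
        · exact haR hzR
        · exact hbR hzR
        · exact hzT h
      · rintro u (rfl | rfl | hu) hua hub v hv huv
        · contradiction
        · contradiction
        · rcases hv with rfl | rfl | hv
          · simp
          · simp
          · simp [hcl u hu v hv huv]
    have h1 := hpart (R ∩ X) Set.inter_subset_left ⟨z, hzR, fun h => hzX h.2⟩
      fun u hu v hv huv => ⟨hv, hcl u hu.1 hu.2 v hv huv⟩
    have h2 := hpart (R \ X) Set.sdiff_subset ⟨t, htR, fun h => h.2 htX⟩
      fun u hu v hv huv => ⟨hv, fun hvX => hu.2 (hcl v hv hvX u hu.1 huv.symm)⟩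
    have h3 := h1.union h2 (by
      ext v
      simp only [Set.mem_inter_iff, Set.mem_insert_iff, Set.mem_sdiff, Set.mem_singleton_iff]
      tauto) (by
      rintro u (rfl | rfl | hu) v (rfl | rfl | hv) huv
      iterate 8 simp
      exact absurd (hcl u hu.1 hu.2 v hv.1 huv) hv.2)
    convert h3 using 1
    ext v
    simp only [Set.mem_inter_iff, Set.mem_insert_iff, Set.mem_sdiff, Set.mem_union]
    tauto
  by_cases haN : ∃ u ∈ R, G.Adj a u
  swap
  · push Not at haN
    exact hasTwoTree_of_pendant hab hGab haR hbR hR hE haN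
  by_cases hbN : ∃ u ∈ R, G.Adj b u
  swap
  · push Not at hbN
    have := hasTwoTree_of_pendant hab.symm (fun h => hGab h.symm) hbR haR hR
      (by rw [Set.insert_comm]; exact hE.symm) hbN
    rw [Set.insert_comm]
    exact this.symm
  obtain ⟨w, Y, hwY, haY, hcl, hbY⟩ : ∃ w, VertexSeparates (restrictTo G R) {u ∈ R | G.Adj a u}
      {u ∈ R | G.Adj b u} w := by
    by_contra! hcon
    exact hK (hasHingedK4_of_not_separates hab hGab haR hbR hR hcon)
  -- A vertex outside the connected set `R` cannot separate inside it.
  have hwR : w ∈ R := by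
    by_contra hwR
    obtain ⟨u, hu, hau⟩ := haN
    obtain ⟨v, hv, hbv⟩ := hbN
    refine hbY v ⟨hv, hbv⟩ (hR.2 Y ⟨u, hu, haY u ⟨hu, hau⟩ ?_⟩ ?_ hv)
    · rintro rfl; contradiction
    · intro u hu huY v hv huv
      refine hcl u huY v ?_ ⟨huv, hu, hv⟩
      rintro rfl; contradiction
  -- `P` is the side of the cut vertex `w` facing `a`, and `Q` the side facing `b`.
  set P := R ∩ Y with hP
  set Q := (R \ Y) \ {w} with hQ
  have hRPQ : R = insert w (P ∪ Q) := by
    ext v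
    simp only [hP, hQ, Set.mem_inter_iff, Set.mem_insert_iff, Set.mem_sdiff, Set.mem_singleton_iff,
      Set.mem_union]
    by_cases hvw : v = w
    · simp [hvw, hwR]
    · tauto
  have haw : a ≠ w := by rintro rfl; contradiction
  have hbw : b ≠ w := by rintro rfl; contradiction
  have haP : a ∉ P := fun h => haR h.1
  have haQ : a ∉ Q := fun h => haR h.1.1
  have hbP : b ∉ P := fun h => hbR h.1
  have hbQ : b ∉ Q := fun h => hbR h.1.1
  have hwP : w ∉ P := fun h => hwY h.2
  have hwQ : w ∉ Q := fun h => h.2 rfl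
  have hPQ : Disjoint P Q := Set.disjoint_left.2 fun v hv hv' => hv'.1.2 hv.2
  have hPQ' : ¬ Touches G P Q := by
    rintro ⟨u, hu, v, hv, huv⟩
    exact hv.1.2 (hcl u hu.2 v hv.2 ⟨huv, hu.1, hv.1.1⟩)
  have hbP' : ∀ u ∈ P, ¬ G.Adj b u := fun u hu hbu => hbY u ⟨hu.1, hbu⟩ hu.2
  have haQ' : ∀ u ∈ Q, ¬ G.Adj a u := fun u hu hau => hu.1.2 (haY u ⟨hu.1.1, hau⟩ hu.2)
  have hbN' : ∃ u ∈ insert w Q, G.Adj b u := by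
    obtain ⟨u, hu, hbu⟩ := hbN
    rw [hRPQ] at hu
    rcases hu with h | h | h
    · exact ⟨u, .inl h, hbu⟩
    · exact absurd hbu (hbP' u h)
    · exact ⟨u, .inr h, hbu⟩
  have haN' : ∃ u ∈ insert w P, G.Adj a u := by
    obtain ⟨u, hu, hau⟩ := haN
    rw [hRPQ] at hu
    rcases hu with h | h | h
    · exact ⟨u, .inl h, hau⟩
    · exact ⟨u, .inr h, hau⟩
    · exact absurd hau (haQ' u h)
  clear_value P Q
  subst hRPQ
  have h1 : HasTwoTree G (insert a (insert w P)) a w := by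
    refine hasTwoTree_side (fun h2 h3 h4 => ih' _ ⟨?_, fun h => ?_⟩ a w haw (by simp) (by simp) h2
      h3 h4) hab haw hbw haP haQ hbP hwP hPQ hGab hPQ' hbP' haQ' hR hbN' hE hK
    · intro v hv
      simp only [Set.mem_insert_iff, Set.mem_union] at hv ⊢
      tauto
    · rcases h (show b ∈ _ from Or.inr (Or.inl rfl)) with h | h | h
      · exact hab h.symm
      · exact hbw h
      · exact hbP h
  have h2 : HasTwoTree G (insert b (insert w Q)) b w := by
    rw [Set.union_comm] at hR
    refine hasTwoTree_side (fun h2 h3 h4 => ih' _ ⟨?_, fun h => ?_⟩ b w hbw (by simp) (by simp) h2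
      h3 h4) hab.symm hbw haw hbQ hbP haQ hwQ hPQ.symm (fun h => hGab h.symm)
      (fun h => hPQ' h.symm) haQ' hbP' hR haN' ?_ ?_
    · intro v hv
      simp only [Set.mem_insert_iff, Set.mem_union] at hv ⊢
      tauto
    · rcases h (show a ∈ _ from Or.inl rfl) with h | h | h
      · exact hab h
      · exact haw h
      · exact haQ h
    · rw [Set.union_comm, Set.insert_comm]; exact hE.symm
    · rw [Set.union_comm, Set.insert_comm]; exact fun h => hK h.symm
  have h3 := HasTwoTree.triangle hab haw hbw h1 h2 (by
      ext v
      constructor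
      · rintro ⟨h | h | hv, h' | h' | hv'⟩
        · exact absurd (h.symm.trans h') hab
        · exact h'
        · exact absurd hv' (h ▸ haQ)
        · exact h
        · exact h
        · exact h
        · exact absurd hv (h' ▸ hbP)
        · exact h'
        · exact absurd hv' (Set.disjoint_left.1 hPQ hv)
      · rintro rfl; simp) (by simp) (by simp) (by
      rintro u (rfl | rfl | hu) v (rfl | rfl | hv) huv
      · contradiction
      · simp
      · exact absurd huv (haQ' v hv)
      · simp
      · simp
      · simp
      · exact absurd huv.symm (hbP' u hu)
      · simp
      · exact absurd ⟨u, hu, v, hv, huv⟩ hPQ')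
  convert h3 using 1
  ext v
  simp only [Set.mem_insert_iff, Set.mem_union]
  tauto

/-! ### 2-sums and their components -/

/-- The overlap is complete, so a summand without further vertices would equal the overlap, against
properness. -/
theorem IsKSum.exists_pair {V : Type*} {H : SimpleGraph V} {A A₁ A₂ : H.Subgraph}
    (h : IsKSum 2 A A₁ A₂) : ∃ x y, x ≠ y ∧ A₁.verts ∩ A₂.verts = {x, y} ∧ A₁.Adj x y ∧
      A₂.Adj x y ∧ (∃ z ∈ A₁.verts, z ∉ A₂.verts) ∧ ∃ z ∈ A₂.verts, z ∉ A₁.verts := by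
  obtain ⟨-, ⟨hcard, hadj⟩, h₁, h₂⟩ := h
  rw [SimpleGraph.Subgraph.verts_inf] at hcard hadj
  obtain ⟨x, y, hxy, hv⟩ := Set.encard_eq_two.1 hcard
  have h' := hadj x (by simp [hv]) y (by simp [hv]) hxy
  refine ⟨x, y, hxy, hv, h'.1, h'.2, ?_, ?_⟩
  · by_contra! hcon
    refine h₁.not_ge ⟨fun v hv' => ⟨hv', hcon v hv'⟩, fun u v huv => ?_⟩
    exact hadj u ⟨huv.fst_mem, hcon u huv.fst_mem⟩ v ⟨huv.snd_mem, hcon v huv.snd_mem⟩ huv.ne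
  · by_contra! hcon
    refine h₂.not_ge ⟨fun v hv' => ⟨hcon v hv', hv'⟩, fun u v huv => ?_⟩
    exact hadj u ⟨hcon u huv.fst_mem, huv.fst_mem⟩ v ⟨hcon v huv.snd_mem, huv.snd_mem⟩ huv.ne

theorem IsKSum.symm {V : Type*} {H : SimpleGraph V} {k : ℕ} {A A₁ A₂ : H.Subgraph}
    (h : IsKSum k A A₁ A₂) : IsKSum k A A₂ A₁ := by
  obtain ⟨h1, h2, h3, h4⟩ := h
  rw [inf_comm] at h2 h3 h4
  rw [sup_comm] at h1
  exact ⟨h1, h2, h4, h3⟩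

/-- The summands of a `k`-sum are induced in it. -/
theorem IsKSum.adj_left {V : Type*} {H : SimpleGraph V} {k : ℕ} {A A₁ A₂ : H.Subgraph}
    (h : IsKSum k A A₁ A₂) {u v : V} (hu : u ∈ A₁.verts) (hv : v ∈ A₁.verts) (huv : A.Adj u v) :
    A₁.Adj u v := by
  rw [← h.1] at huv
  rcases huv with huv | huv
  · exact huv
  · exact (h.2.1.2 u ⟨hu, huv.fst_mem⟩ v ⟨hv, huv.snd_mem⟩ huv.ne).1

/-- Splitting keeps summands induced, so components are determined by, and can be compared through,
their vertex sets. -/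
theorem IsKSumComponent.adj {V : Type*} {H : SimpleGraph V} {k : ℕ} {A : H.Subgraph}
    (h : IsKSumComponent k H A) {u v : V} (hu : u ∈ A.verts) (hv : v ∈ A.verts)
    (huv : H.Adj u v) : A.Adj u v := by
  induction h with
  | whole => exact huv
  | left _ hs ih =>
    rw [← hs.1] at ih
    exact hs.adj_left hu hv (hs.1 ▸ ih (.inl hu) (.inl hv))
  | right _ hs ih =>
    rw [← hs.1] at ih
    exact hs.symm.adj_left hu hv (hs.1 ▸ ih (.inr hu) (.inr hv))

/-- A component other than the whole graph has a vertex besides any given pair. -/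
theorem IsKSumComponent.exists_third {V : Type*} {H : SimpleGraph V} {A : H.Subgraph}
    (h : IsKSumComponent 2 H A) (hA : A ≠ ⊤) (a b : V) : ∃ z ∈ A.verts, z ≠ a ∧ z ≠ b := by
  have key : ∀ {B A₁ A₂ : H.Subgraph}, IsKSum 2 B A₁ A₂ → ∃ z ∈ A₁.verts, z ≠ a ∧ z ≠ b := by
    intro B A₁ A₂ hs
    obtain ⟨x, y, hxy, hv, -, -, ⟨z, hz, hz'⟩, -⟩ := hs.exists_pair
    have hx : x ∈ A₁.verts ∩ A₂.verts := by simp [hv]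
    have hy : y ∈ A₁.verts ∩ A₂.verts := by simp [hv]
    have hzx : z ≠ x := fun h => hz' (h ▸ hx.2)
    have hzy : z ≠ y := fun h => hz' (h ▸ hy.2)
    by_contra! hcon
    have h1 := hcon x hx.1
    have h2 := hcon y hy.1
    have h3 := hcon z hz
    clear hcon hv hx hy
    by_cases hxa : x = a <;> by_cases hya : y = a <;> by_cases hza : z = a <;> simp_all
  cases h with
  | whole => exact absurd rfl hA
  | left _ hs => exact key hs
  | right _ hs => exact key hs.symm

/-- Splitting a subgraph at an edge `xy` that separates it. -/
theorem isKSum_induce {V : Type*} {H : SimpleGraph V} {A : H.Subgraph} {S T : Set V} {x y : V}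
    (hxy : A.Adj x y) (hST : S ∪ T = A.verts) (hI : S ∩ T = {x, y})
    (hS : ∃ z ∈ S, z ∉ T) (hT : ∃ z ∈ T, z ∉ S)
    (hadj : ∀ u ∈ S, ∀ v ∈ T, A.Adj u v → u ∈ T ∨ v ∈ S) :
    IsKSum 2 A (A.induce S) (A.induce T) := by
  obtain ⟨s, hs, hs'⟩ := hS
  obtain ⟨t, ht, ht'⟩ := hT
  refine ⟨?_, ⟨?_, ?_⟩, ?_, ?_⟩
  · refine SimpleGraph.Subgraph.ext hST ?_
    ext u v
    constructor
    · rintro (⟨-, -, h⟩ | ⟨-, -, h⟩) <;> exact h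
    · intro h
      have hu : u ∈ S ∪ T := hST ▸ h.fst_mem
      have hv : v ∈ S ∪ T := hST ▸ h.snd_mem
      rcases hu with hu | hu <;> rcases hv with hv | hv
      · exact .inl ⟨hu, hv, h⟩
      · rcases hadj u hu v hv h with h1 | h1
        · exact .inr ⟨h1, hv, h⟩
        · exact .inl ⟨hu, h1, h⟩
      · rcases hadj v hv u hu h.symm with h1 | h1
        · exact .inr ⟨hu, h1, h⟩
        · exact .inl ⟨h1, hv, h⟩
      · exact .inr ⟨hu, hv, h⟩
  · change (S ∩ T).encard = _
    rw [hI, Set.encard_pair hxy.ne]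
    rfl
  · change ∀ u ∈ S ∩ T, ∀ v ∈ S ∩ T, _
    intro u hu v hv huv
    suffices A.Adj u v from ⟨⟨hu.1, hv.1, this⟩, ⟨hu.2, hv.2, this⟩⟩
    rw [hI] at hu hv
    rcases hu with rfl | rfl <;> rcases hv with rfl | rfl
    · exact absurd rfl huv
    · exact hxy
    · exact hxy.symm
    · exact absurd rfl huv
  · exact lt_of_le_not_ge inf_le_left fun h => hs' (h.1 hs).2
  · exact lt_of_le_not_ge inf_le_right fun h => ht' (h.1 ht).1

/-! ### From 2-trees inside `V` to 2-trees on `Fin n` -/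

theorem IsKTreeSubgraph.comap {V W : Type*} {k : ℕ} {T : SimpleGraph V} {T' : SimpleGraph W}
    (φ : T' →g T) (hφ : Function.Injective φ) {B : T.Subgraph} (h : IsKTreeSubgraph k T B)
    (hrange : B.verts ⊆ Set.range φ) (hadj : ∀ i j, B.Adj (φ i) (φ j) → T'.Adj i j) :
    IsKTreeSubgraph k T' (B.comap φ) := by
  induction h with
  | @simplex A hA =>
    refine .simplex ⟨?_, fun u hu v hv huv => ?_⟩
    · rw [← hA.1]
      exact Set.encard_preimage_of_injective_subset_range hφ hrange
    · have := hA.2 _ hu _ hv (hφ.ne huv)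
      exact ⟨hadj u v this, this⟩
  | @sum A A₁ A₂ _ _ hs ih₁ ih₂ =>
    obtain ⟨rfl, ⟨hc, hcl⟩, h₁, h₂⟩ := hs
    have hr₁ : A₁.verts ⊆ Set.range φ := fun v hv => hrange (.inl hv)
    have hr₂ : A₂.verts ⊆ Set.range φ := fun v hv => hrange (.inr hv)
    have ha₁ : ∀ i j, A₁.Adj (φ i) (φ j) → T'.Adj i j := fun i j h => hadj i j (.inl h)
    have ha₂ : ∀ i j, A₂.Adj (φ i) (φ j) → T'.Adj i j := fun i j h => hadj i j (.inr h)
    have hlt : ∀ C : T.Subgraph, C.verts ⊆ Set.range φ →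
        (∀ i j, C.Adj (φ i) (φ j) → T'.Adj i j) → A₁ ⊓ A₂ < C →
        ¬ C.comap φ ≤ A₁.comap φ ⊓ A₂.comap φ := by
      intro C hr ha hC hle
      refine hC.not_ge ⟨fun v hv => ?_, fun u v huv => ?_⟩
      · obtain ⟨i, rfl⟩ := hr hv
        exact hle.1 hv
      · obtain ⟨i, rfl⟩ := hr huv.fst_mem
        obtain ⟨j, rfl⟩ := hr huv.snd_mem
        have := hle.2 (⟨ha i j huv, huv⟩ : (C.comap φ).Adj i j)
        exact ⟨this.1.2, this.2.2⟩
    refine .sum (ih₁ hr₁ ha₁) (ih₂ hr₂ ha₂) ⟨?_, ⟨?_, ?_⟩, ?_, ?_⟩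
    · refine SimpleGraph.Subgraph.ext rfl ?_
      ext u v
      constructor
      · rintro (⟨h, h'⟩ | ⟨h, h'⟩)
        · exact ⟨h, .inl h'⟩
        · exact ⟨h, .inr h'⟩
      · rintro ⟨h, h' | h'⟩
        · exact .inl ⟨h, h'⟩
        · exact .inr ⟨h, h'⟩
    · rw [← hc]
      exact Set.encard_preimage_of_injective_subset_range hφ
        (fun v hv => hr₁ hv.1 : (A₁ ⊓ A₂).verts ⊆ _)
    · intro u hu v hv huv
      have := hcl _ hu _ hv (hφ.ne huv)
      exact ⟨⟨ha₁ u v this.1, this.1⟩, ⟨ha₂ u v this.2, this.2⟩⟩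
    · exact lt_of_le_not_ge inf_le_left (hlt A₁ hr₁ ha₁ h₁)
    · exact lt_of_le_not_ge inf_le_right (hlt A₂ hr₂ ha₂ h₂)

theorem HasTwoTree.isPartialKTree {V : Type*} [Finite V] {G H : SimpleGraph V} {A : H.Subgraph}
    {a b : V} (h : HasTwoTree G A.verts a b)
    (hA : ∀ u v, A.Adj u v → G.Adj u v ∨ (u = a ∧ v = b) ∨ (u = b ∧ v = a)) :
    IsPartialKTree 2 A.coe := by
  classical
  rcases h with h | ⟨B, hB, hv, hab, hBG⟩
  -- A single pair is not a 2-tree, so it is embedded into a triangle.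
  · have hinj : Function.Injective fun v : A.verts => (if v = a then 0 else 1 : Fin 3) := by
      rintro ⟨u, hu⟩ ⟨v, hv⟩ huv
      rw [h] at hu hv
      by_cases hua : u = a <;> by_cases hva : v = a <;> simp [hua, hva] at huv ⊢
      exact (hu.resolve_left hua).trans (hv.resolve_left hva).symm
    refine ⟨3, ⊤, .simplex ⟨?_, fun u _ v _ huv => huv⟩, ⟨⟨⟨_, fun {u v} huv => ?_⟩, hinj⟩⟩⟩
    · rw [SimpleGraph.Subgraph.verts_top, Set.encard_univ]
      simp
    · exact hinj.ne huv.ne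
  · have hmem : ∀ v : A.verts, (v : V) ∈ B.verts := fun v => by rw [hv]; exact v.2
    let e : B.verts ≃ Fin (Nat.card B.verts) := Finite.equivFin _
    let T : SimpleGraph (Fin (Nat.card B.verts)) := B.coe.comap e.symm
    let φ : T →g (⊤ : SimpleGraph V) := ⟨fun i => (e.symm i : V), fun {i j} hij => B.adj_sub hij⟩
    have hφ : Function.Injective φ := Subtype.val_injective.comp e.symm.injective
    have hT := hB.comap φ hφ (fun v hv => ⟨e ⟨v, hv⟩, congrArg Subtype.val (e.symm_apply_apply ⟨v, hv⟩)⟩) (fun i j h => h)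
    refine ⟨_, T, ?_, ⟨⟨⟨fun v => e ⟨v, hmem v⟩, fun {u v} huv => ?_⟩, ?_⟩⟩⟩
    · have : B.comap φ = ⊤ := by
        refine SimpleGraph.Subgraph.ext ?_ ?_
        · exact Set.eq_univ_of_forall fun i => (e.symm i).2
        · ext i j
          exact ⟨fun h => h.1, fun h => ⟨h, h⟩⟩
      rw [IsKTree, ← this]
      exact hT
    · have huv : A.Adj u v := huv
      have key : B.Adj u v := by
        rcases hA _ _ huv with h | ⟨h, h'⟩ | ⟨h, h'⟩
        · exact hBG _ u.2 _ v.2 h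
        · rw [h, h']; exact hab
        · rw [h, h']; exact hab.symm
      change B.Adj (e.symm (e ⟨u, hmem u⟩)) (e.symm (e ⟨v, hmem v⟩))
      rwa [e.symm_apply_apply, e.symm_apply_apply]
    · intro u v huv
      have := e.injective huv
      simpa [Subtype.ext_iff] using this

/-! ### Flattening 2-trees into the plane -/

/-- Put `u` on the first axis. Then `v` has first coordinate `⟪u, v⟫ / ‖u‖` (or 0 if `u = 0`), and
Cauchy–Schwarz leaves a nonnegative square for the second. -/
theorem exists_plane_triangle {F : Type*} [NormedAddCommGroup F] [InnerProductSpace ℝ F] (u v : F) :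
    ∃ u' v' : EuclideanSpace ℝ (Fin 2), ‖u'‖ = ‖u‖ ∧ ‖v'‖ = ‖v‖ ∧ ‖u' - v'‖ = ‖u - v‖ := by
  obtain ⟨s, hs, hsv⟩ : ∃ s : ℝ, ‖u‖ * s = inner ℝ u v ∧ s ^ 2 ≤ ‖v‖ ^ 2 := by
    by_cases hu : u = 0
    · exact ⟨0, by simp [hu], by simp⟩
    · have hu' : 0 < ‖u‖ := norm_pos_iff.2 hu
      refine ⟨inner ℝ u v / ‖u‖, by field_simp, ?_⟩
      rw [div_pow, div_le_iff₀ (by positivity), ← mul_pow, sq_le_sq, mul_comm ‖v‖]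
      exact (abs_real_inner_le_norm u v).trans (le_abs_self _)
  set r := √(‖v‖ ^ 2 - s ^ 2) with hr
  have hr2 : r ^ 2 = ‖v‖ ^ 2 - s ^ 2 := Real.sq_sqrt (by linarith)
  refine ⟨!₂[‖u‖, 0], !₂[s, r], ?_, ?_, ?_⟩
  · rw [EuclideanSpace.norm_eq]
    simp
  · rw [EuclideanSpace.norm_eq, Real.sqrt_eq_iff_eq_sq (by positivity) (by positivity)]
    simp [hr2]
  · rw [EuclideanSpace.norm_eq, Real.sqrt_eq_iff_eq_sq (by positivity) (by positivity)]
    rw [norm_sub_sq_real]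
    simp [hr2]
    nlinarith

/-- After translating `q x` to `p x`, reflection in the hyperplane orthogonal to `a - b` exchanges
the equally long vectors `a` and `b`. -/
theorem exists_congruent_through {V F : Type*} [NormedAddCommGroup F] [InnerProductSpace ℝ F]
    (p q : V → F) {x y : V} (h : dist (p x) (p y) = dist (q x) (q y)) :
    ∃ r : V → F, (∀ u v, dist (r u) (r v) = dist (q u) (q v)) ∧ r x = p x ∧ r y = p y := by
  set a := q y - q x with ha
  set b := p y - p x with hb
  have hab : ‖a‖ = ‖b‖ := by
    rw [ha, hb, ← dist_eq_norm, ← dist_eq_norm, dist_comm, ← h, dist_comm]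
  refine ⟨fun u => (Submodule.span ℝ {a - b})ᗮ.reflection (q u - q x) + p x, fun u v => ?_, ?_, ?_⟩
  · rw [dist_add_right, LinearIsometryEquiv.dist_map, dist_sub_right]
  · simp
  · change (Submodule.span ℝ {a - b})ᗮ.reflection a + p x = p y
    rw [Submodule.reflection_sub hab, hb]
    simp

/-- Two placements that agree in the distance of two common vertices can be glued there. -/
theorem exists_glued {V F : Type*} [NormedAddCommGroup F] [InnerProductSpace ℝ F]
    (p q : V → F) {S T : Set V} {x y : V} (hST : S ∩ T = {x, y})
    (h : dist (p x) (p y) = dist (q x) (q y)) :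
    ∃ r : V → F, (∀ u ∈ S, r u = p u) ∧
      ∀ u ∈ T, ∀ v ∈ T, dist (r u) (r v) = dist (q u) (q v) := by
  classical
  obtain ⟨q', hq', hx, hy⟩ := exists_congruent_through p q h
  have key : ∀ u ∈ T, (if u ∈ S then p u else q' u) = q' u := by
    intro u hu
    by_cases huS : u ∈ S
    · have : u ∈ S ∩ T := ⟨huS, hu⟩
      rw [hST] at this
      rcases this with rfl | rfl
      · simp [huS, hx]
      · simp [huS, hy]
    · simp [huS]
  refine ⟨fun u => if u ∈ S then p u else q' u, fun u hu => if_pos hu, fun u hu v hv => ?_⟩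
  simp only [key u hu, key v hv, hq']

/-- A placement of a `2`-tree in any inner product space can be flattened into the plane without
changing edge lengths. -/
theorem IsKTreeSubgraph.exists_flattening {V F : Type*} [NormedAddCommGroup F]
    [InnerProductSpace ℝ F] {T : SimpleGraph V} {A : T.Subgraph} (h : IsKTreeSubgraph 2 T A)
    (P : V → F) : ∃ p : V → EuclideanSpace ℝ (Fin 2),
      ∀ u v, A.Adj u v → dist (p u) (p v) = dist (P u) (P v) := by
  classical
  induction h with
  | @simplex A hA =>
    obtain ⟨a, b, c, hab, hac, hbc, hv⟩ := Set.encard_eq_three.1 hA.1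
    obtain ⟨b', c', hb', hc', hbc'⟩ := exists_plane_triangle (P b - P a) (P c - P a)
    have h1 : dist b' 0 = dist (P b) (P a) := by rw [dist_zero_right, hb', dist_eq_norm]
    have h2 : dist c' 0 = dist (P c) (P a) := by rw [dist_zero_right, hc', dist_eq_norm]
    have h3 : dist b' c' = dist (P b) (P c) := by
      rw [dist_eq_norm, hbc', dist_eq_norm, sub_sub_sub_cancel_right]
    refine ⟨fun u => if u = a then 0 else if u = b then b' else c', fun u v huv => ?_⟩
    have hu := huv.fst_mem
    have hv' := huv.snd_mem
    rw [hv] at hu hv'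
    rcases hu with rfl | rfl | rfl <;> rcases hv' with rfl | rfl | rfl <;>
      simp [hab.symm, hac.symm, hbc.symm, h1, h2, h3, dist_comm, -dist_zero_right, -dist_eq_zero]
  | @sum A A₁ A₂ _ _ hs ih₁ ih₂ =>
    obtain ⟨p, hp⟩ := ih₁
    obtain ⟨q, hq⟩ := ih₂
    obtain ⟨x, y, -, hv, hxy₁, hxy₂, -⟩ := hs.exists_pair
    -- The hinge is an edge of both summands, so both flattenings give it the length it has under
    -- `P`.
    obtain ⟨r, hr₁, hr₂⟩ := exists_glued p q hv (by rw [hp x y hxy₁, hq x y hxy₂])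
    refine ⟨r, fun u v huv => ?_⟩
    rw [← hs.1] at huv
    rcases huv with huv | huv
    · rw [hr₁ u huv.fst_mem, hr₁ v huv.snd_mem, hp u v huv]
    · rw [hr₂ u huv.fst_mem v huv.snd_mem, hq u v huv]

theorem IsPartialKTree.exists_flattening {V F : Type*} [NormedAddCommGroup F]
    [InnerProductSpace ℝ F] {H : SimpleGraph V} {A : H.Subgraph} (h : IsPartialKTree 2 A.coe)
    (P : V → F) : ∃ p : V → EuclideanSpace ℝ (Fin 2),
      ∀ u v, A.Adj u v → dist (p u) (p v) = dist (P u) (P v) := by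
  classical
  obtain ⟨n, T, hT, ⟨f⟩⟩ := h
  obtain ⟨p, hp⟩ := hT.exists_flattening (Function.extend f (fun v => P v) fun _ => 0)
  refine ⟨fun u => if hu : u ∈ A.verts then p (f ⟨u, hu⟩) else 0, fun u v huv => ?_⟩
  have hu := huv.fst_mem
  have hv := huv.snd_mem
  have h1 : T.Adj (f ⟨u, hu⟩) (f ⟨v, hv⟩) :=
    f.toHom.map_adj (show A.coe.Adj ⟨u, hu⟩ ⟨v, hv⟩ from huv)
  have hf : Function.Injective f := f.injective
  simp only [hu, hv, dif_pos]
  rw [hp _ _ h1, hf.extend_apply, hf.extend_apply]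

/-! ### A hinged `K₄` produces a gap in the configuration space -/

/-- In the plane, two apexes of isosceles right triangles on a common hypotenuse of length `2`
have distance `0` or `2`. -/
theorem dist_apexes_ne_one {a b c d : EuclideanSpace ℝ (Fin 2)} (hac : dist a c = √2)
    (had : dist a d = √2) (hbc : dist b c = √2) (hbd : dist b d = √2) (hcd : dist c d = 2) :
    dist a b ≠ 1 := by
  intro hab
  have key : ∀ {x y : EuclideanSpace ℝ (Fin 2)} {t : ℝ}, dist x y = t →
      (x 0 - y 0) ^ 2 + (x 1 - y 1) ^ 2 = t ^ 2 := by
    rintro x y t rfl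
    rw [EuclideanSpace.dist_eq, Real.sq_sqrt (by positivity)]
    simp [Real.dist_eq]
  have h2 : √2 ^ 2 = (2 : ℝ) := Real.sq_sqrt (by norm_num)
  have h1 := key hac
  have h3 := key had
  have h4 := key hbc
  have h5 := key hbd
  have h6 := key hcd
  have h7 := key hab
  rw [h2] at h1 h3 h4 h5
  generalize a 0 = a0 at *
  generalize a 1 = a1 at *
  generalize b 0 = b0 at *
  generalize b 1 = b1 at *
  generalize c 0 = c0 at *
  generalize c 1 = c1 at *
  generalize d 0 = d0 at *
  generalize d 1 = d1 at *
  clear hac had hbc hbd hcd hab key h2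
  -- coordinates relative to the midpoint of `c` and `d`
  obtain ⟨x, hx⟩ : ∃ x, x = a0 - (c0 + d0) / 2 := ⟨_, rfl⟩
  obtain ⟨y, hy⟩ : ∃ y, y = a1 - (c1 + d1) / 2 := ⟨_, rfl⟩
  obtain ⟨z, hz⟩ : ∃ z, z = b0 - (c0 + d0) / 2 := ⟨_, rfl⟩
  obtain ⟨w, hw⟩ : ∃ w, w = b1 - (c1 + d1) / 2 := ⟨_, rfl⟩
  obtain ⟨e, he⟩ : ∃ e, e = (d0 - c0) / 2 := ⟨_, rfl⟩
  obtain ⟨f, hf⟩ : ∃ f, f = (d1 - c1) / 2 := ⟨_, rfl⟩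
  have hef : e ^ 2 + f ^ 2 = 1 := by rw [he, hf]; linarith
  have hxy : x * e + y * f = 0 := by rw [hx, hy, he, hf]; linarith
  have hzw : z * e + w * f = 0 := by rw [hz, hw, he, hf]; linarith
  have hx1 : x ^ 2 + y ^ 2 = 1 := by rw [hx, hy]; linarith
  have hz1 : z ^ 2 + w ^ 2 = 1 := by rw [hz, hw]; linarith
  have hdot : x * z + y * w = 1 / 2 := by
    have : (x - z) ^ 2 + (y - w) ^ 2 = 1 := by rw [hx, hy, hz, hw]; linarith
    linarith
  -- Both apex vectors are orthogonal to the unit vector `(e, f)`, hence parallel. Lagrange's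
  -- identity then reads `1/4 = 1`.
  have hcr : x * w - y * z = 0 := by
    have h1 : e * (x * w - y * z) = 0 := by linear_combination w * hxy - y * hzw
    have h2 : f * (x * w - y * z) = 0 := by linear_combination x * hzw - z * hxy
    linear_combination e * h1 + f * h2 - (x * w - y * z) * hef
  have : (x * z + y * w) ^ 2 + (x * w - y * z) ^ 2 = (x ^ 2 + y ^ 2) * (z ^ 2 + w ^ 2) := by ring
  rw [hdot, hcr, hx1, hz1] at this
  norm_num at this

theorem IsHingedK4.not_ordConnected {V : Type*} {G : SimpleGraph V} {a b : V} {A B C D : Set V}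
    (h : IsHingedK4 G a b A B C D) :
    ∃ δ : G.edgeSet → ℝ≥0, ¬ (cayleyConfigurationSpace 2 G a b δ).OrdConnected := by
  classical
  -- Vertices outside all four branch sets are placed together with `C`.
  let q : ℝ → V → EuclideanSpace ℝ (Fin 2) := fun t u =>
    if u ∈ A then !₂[0, 1] else if u ∈ B then !₂[0, t] else if u ∈ D then !₂[1, 0] else !₂[-1, 0]
  have qA : ∀ t, ∀ u ∈ A, q t u = !₂[0, 1] := fun t u hu => if_pos hu
  have qB : ∀ t, ∀ u ∈ B, q t u = !₂[0, t] := fun t u hu => by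
    simp [q, Set.disjoint_right.1 h.disjAB hu, hu]
  have qD : ∀ t, ∀ u ∈ D, q t u = !₂[1, 0] := fun t u hu => by
    simp [q, Set.disjoint_right.1 h.disjAD hu, Set.disjoint_right.1 h.disjBD hu, hu]
  have qC : ∀ t, ∀ u ∈ C, q t u = !₂[-1, 0] := fun t u hu => by
    simp [q, Set.disjoint_right.1 h.disjAC hu, Set.disjoint_right.1 h.disjBC hu,
      Set.disjoint_left.1 h.disjCD hu]
  have hd : ∀ x y z w : ℝ, dist (!₂[x, y] : EuclideanSpace ℝ (Fin 2)) !₂[z, w] =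
      √((x - z) ^ 2 + (y - w) ^ 2) := by
    intro x y z w
    rw [EuclideanSpace.dist_eq]
    simp [Real.dist_eq]
  -- Only `B` moves. Its neighbours outside `B` avoid `A`, so they lie on the first axis, which is
  -- equidistant from `(0, 1)` and `(0, -1)`.
  have hq : ∀ u v, G.Adj u v → dist (q (-1) u) (q (-1) v) = dist (q 1 u) (q 1 v) := by
    intro u v huv
    have hAB : ∀ {u v}, G.Adj u v → u ∈ A → v ∉ B := fun huv hu hv =>
      h.not_touches ⟨_, hu, _, hv, huv⟩
    by_cases hu : u ∈ B <;> by_cases hv : v ∈ B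
    · simp [qB _ u hu, qB _ v hv]
    · have hvA : v ∉ A := fun hvA => hAB huv.symm hvA hu
      rw [qB _ u hu, qB _ u hu]
      by_cases hvD : v ∈ D <;> simp [q, hv, hvA, hvD, hd]
    · have huA : u ∉ A := fun huA => hAB huv huA hv
      rw [qB _ v hv, qB _ v hv]
      by_cases huD : u ∈ D <;> simp [q, hu, huA, huD, hd]
    · simp [q, hu, hv]
  let δ : G.edgeSet → ℝ≥0 := fun e => Sym2.lift ⟨fun u v => nndist (q 1 u) (q 1 v),
    fun u v => nndist_comm _ _⟩ e.1
  have hδ : ∀ u v (huv : G.Adj u v), (δ ⟨s(u, v), huv⟩ : ℝ) = dist (q 1 u) (q 1 v) :=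
    fun u v huv => rfl
  refine ⟨δ, fun hoc => ?_⟩
  have h0 : (0 : ℝ) ∈ cayleyConfigurationSpace 2 G a b δ :=
    ⟨q 1, fun u v huv => (hδ u v huv).symm, by rw [qA _ a h.mem_left, qB _ b h.mem_right, dist_self]⟩
  have h2 : (2 : ℝ) ∈ cayleyConfigurationSpace 2 G a b δ := by
    refine ⟨q (-1), fun u v huv => (hq u v huv).trans (hδ u v huv).symm, ?_⟩
    rw [qA _ a h.mem_left, qB _ b h.mem_right, hd]
    norm_num
  obtain ⟨p, hp, hp1⟩ := hoc.out h0 h2 (⟨by norm_num, by norm_num⟩ : (1 : ℝ) ∈ Set.Icc 0 2)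
  have hp' : ∀ u v, G.Adj u v → dist (p u) (p v) = dist (q 1 u) (q 1 v) :=
    fun u v huv => (hp u v huv).trans (hδ u v huv)
  -- `p` is constant on each branch set
  have hconst : ∀ E : Set V, ConnectedOn G E → (∀ u ∈ E, ∀ v ∈ E, q 1 u = q 1 v) →
      ∀ u ∈ E, ∀ v ∈ E, p u = p v := by
    intro E hE hqE u hu v hv
    refine (hE.2 {x | p u = p x} ⟨u, hu, rfl⟩ (fun x hx hux y hy hxy => ?_) hv)
    refine Eq.trans hux (dist_eq_zero.1 ?_)
    rw [hp' x y hxy, hqE x hx y hy, dist_self]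
  have hA := hconst A h.connA fun u hu v hv => by rw [qA _ u hu, qA _ v hv]
  have hB := hconst B h.connB fun u hu v hv => by rw [qB _ u hu, qB _ v hv]
  have hC := hconst C h.connC fun u hu v hv => by rw [qC _ u hu, qC _ v hv]
  have hD := hconst D h.connD fun u hu v hv => by rw [qD _ u hu, qD _ v hv]
  obtain ⟨c, hc⟩ := h.connC.1
  obtain ⟨d, hd'⟩ := h.connD.1
  have hdist : ∀ {E F : Set V} {e f : V}, Touches G E F → (∀ u ∈ E, ∀ v ∈ E, p u = p v) →
      (∀ u ∈ F, ∀ v ∈ F, p u = p v) → (∀ u ∈ E, ∀ v ∈ E, q 1 u = q 1 v) →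
      (∀ u ∈ F, ∀ v ∈ F, q 1 u = q 1 v) → e ∈ E → f ∈ F →
      dist (p e) (p f) = dist (q 1 e) (q 1 f) := by
    rintro E F e f ⟨u, hu, v, hv, huv⟩ hE hF hE' hF' he hf
    rw [hE e he u hu, hF f hf v hv, hE' e he u hu, hF' f hf v hv, hp' u v huv]
  have rA : ∀ u ∈ A, ∀ v ∈ A, q 1 u = q 1 v := fun u hu v hv => by rw [qA _ u hu, qA _ v hv]
  have rB : ∀ u ∈ B, ∀ v ∈ B, q 1 u = q 1 v := fun u hu v hv => by rw [qB _ u hu, qB _ v hv]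
  have rC : ∀ u ∈ C, ∀ v ∈ C, q 1 u = q 1 v := fun u hu v hv => by rw [qC _ u hu, qC _ v hv]
  have rD : ∀ u ∈ D, ∀ v ∈ D, q 1 u = q 1 v := fun u hu v hv => by rw [qD _ u hu, qD _ v hv]
  refine dist_apexes_ne_one ((hdist h.touchAC hA hC rA rC h.mem_left hc).trans ?_)
    ((hdist h.touchAD hA hD rA rD h.mem_left hd').trans ?_)
    ((hdist h.touchBC hB hC rB rC h.mem_right hc).trans ?_)
    ((hdist h.touchBD hB hD rB rD h.mem_right hd').trans ?_)
    ((hdist h.touchCD hC hD rC rD hc hd').trans ?_) hp1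
  · rw [qA _ a h.mem_left, qC _ c hc, hd]; norm_num
  · rw [qA _ a h.mem_left, qD _ d hd', hd]; norm_num
  · rw [qB _ b h.mem_right, qC _ c hc, hd]; norm_num
  · rw [qB _ b h.mem_right, qD _ d hd', hd]; norm_num
  · rw [qC _ c hc, qD _ d hd', hd]
    exact (Real.sqrt_eq_iff_eq_sq (by norm_num) (by norm_num)).2 (by norm_num)

/-! ### Components that cannot be split -/

/-- A component that no edge other than the pair `ab` splits is edge-inseparable. -/
theorem edgeInseparable_of_isKSumComponent {V : Type*} {G : SimpleGraph V} {a b : V}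
    (hab : a ≠ b) (hGab : ¬ G.Adj a b) {A : (G ⊔ SimpleGraph.edge a b).Subgraph}
    (hA : IsKSumComponent 2 (G ⊔ SimpleGraph.edge a b) A) (ha : a ∈ A.verts) (hb : b ∈ A.verts)
    (hno : ∀ A₁ A₂, IsKSum 2 A A₁ A₂ → a ∈ A₁.verts → b ∉ A₁.verts) :
    EdgeInseparable G A.verts a b := by
  intro x hx y hy hxy T hT haT hbT hxT hyT hcl
  by_contra hne
  obtain ⟨t, ht⟩ := Set.nonempty_iff_ne_empty.2 hne
  refine hno _ _ (isKSum_induce (S := A.verts \ T) (T := T ∪ {x, y}) (hA.adj hx hy (.inl hxy))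
    ?_ ?_ ?_ ⟨t, .inl ht, fun h => h.2 ht⟩ ?_) ⟨ha, haT⟩ ⟨hb, hbT⟩
  · ext v
    constructor
    · rintro (h | h | rfl | rfl)
      · exact h.1
      · exact hT h
      · exact hx
      · exact hy
    · intro h
      by_cases hv : v ∈ T
      · exact .inr (.inl hv)
      · exact .inl ⟨h, hv⟩
  · ext v
    constructor
    · rintro ⟨h, h' | h'⟩
      · exact absurd h' h.2
      · exact h'
    · rintro (rfl | rfl)
      · exact ⟨⟨hx, hxT⟩, by simp⟩
      · exact ⟨⟨hy, hyT⟩, by simp⟩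
  -- Otherwise both `a` and `b` lie in `{x, y}`, making `ab` an edge of `G`.
  · by_contra! hcon
    have h1 := (hcon a ⟨ha, haT⟩).resolve_left haT
    have h2 := (hcon b ⟨hb, hbT⟩).resolve_left hbT
    rcases h1 with rfl | rfl <;> rcases h2 with rfl | rfl
    · exact hab rfl
    · exact hGab hxy
    · exact hGab hxy.symm
    · exact hab rfl
  · rintro u hu v (hv | rfl | rfl) huv
    · rcases A.adj_sub huv with h | h
      · rcases hcl v hv u hu.1 h.symm with h | h | h
        · exact absurd h hu.2
        · exact .inl (by simp [h])
        · exact .inl (by simp [h])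
      · rw [SimpleGraph.edge_adj] at h
        rcases h with ⟨⟨-, rfl⟩ | ⟨-, rfl⟩, -⟩ <;> contradiction
    · exact .inr ⟨hx, hxT⟩
    · exact .inr ⟨hy, hyT⟩

/-- In a component that cannot be split, the pair `ab` does not separate. -/
theorem eq_of_closed_of_isKSumComponent {V : Type*} {G : SimpleGraph V} {a b : V} (hab : a ≠ b)
    {A : (G ⊔ SimpleGraph.edge a b).Subgraph}
    (hA : IsKSumComponent 2 (G ⊔ SimpleGraph.edge a b) A) (ha : a ∈ A.verts) (hb : b ∈ A.verts)
    (hno : ∀ A₁ A₂, ¬ IsKSum 2 A A₁ A₂) {T : Set V} (hT : T ⊆ A.verts) (hTne : T.Nonempty)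
    (haT : a ∉ T) (hbT : b ∉ T)
    (hcl : ∀ u ∈ T, ∀ v ∈ A.verts, G.Adj u v → v ∈ T ∨ v = a ∨ v = b) :
    A.verts = insert a (insert b T) := by
  obtain ⟨t, ht⟩ := hTne
  by_contra hcon
  refine hno _ _ (isKSum_induce (S := A.verts \ T) (T := T ∪ {a, b})
    (hA.adj ha hb (.inr (by simp [SimpleGraph.edge_adj, hab]))) ?_ ?_ ?_
    ⟨t, .inl ht, fun h => h.2 ht⟩ ?_)
  · ext v
    constructor
    · rintro (h | h | rfl | rfl)
      · exact h.1
      · exact hT h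
      · exact ha
      · exact hb
    · intro h
      by_cases hv : v ∈ T
      · exact .inr (.inl hv)
      · exact .inl ⟨h, hv⟩
  · ext v
    constructor
    · rintro ⟨h, h' | h'⟩
      · exact absurd h' h.2
      · exact h'
    · rintro (rfl | rfl)
      · exact ⟨⟨ha, haT⟩, by simp⟩
      · exact ⟨⟨hb, hbT⟩, by simp⟩
  · by_contra! h
    refine hcon (Set.Subset.antisymm (fun v hv => ?_) ?_)
    · by_cases hvT : v ∈ T
      · exact .inr (.inr hvT)
      · rcases h v ⟨hv, hvT⟩ with h | rfl | rfl
        · exact absurd h hvT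
        · simp
        · simp
    · rintro v (rfl | rfl | hv)
      · exact ha
      · exact hb
      · exact hT hv
  · rintro u hu v (hv | rfl | rfl) huv
    · rcases A.adj_sub huv with h | h
      · rcases hcl v hv u hu.1 h.symm with h | h | h
        · exact absurd h hu.2
        · exact .inl (by simp [h])
        · exact .inl (by simp [h])
      · rw [SimpleGraph.edge_adj] at h
        rcases h with ⟨⟨-, rfl⟩ | ⟨-, rfl⟩, -⟩ <;> contradiction
    · exact .inr ⟨ha, haT⟩
    · exact .inr ⟨hb, hbT⟩

/-- A component that cannot be split and is nevertheless not minimal consists of the pair `ab` and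
one more edge, so it lies in a `2`-tree. -/
theorem hasTwoTree_of_not_minimal {V : Type*} {G : SimpleGraph V} {a b : V} (hab : a ≠ b)
    (hGab : ¬ G.Adj a b) {A A' : (G ⊔ SimpleGraph.edge a b).Subgraph}
    (hA : IsKSumComponent 2 (G ⊔ SimpleGraph.edge a b) A) (ha : a ∈ A.verts) (hb : b ∈ A.verts)
    (hno : ∀ A₁ A₂, ¬ IsKSum 2 A A₁ A₂)
    (hA' : IsKSumComponent 2 (G ⊔ SimpleGraph.edge a b) A') (ha' : a ∈ A'.verts)
    (hb' : b ∈ A'.verts) (hlt : A' < A) : HasTwoTree G A.verts a b := by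
  by_contra hcon
  have hE := edgeInseparable_of_isKSumComponent hab hGab hA ha hb fun A₁ A₂ h => absurd h (hno A₁ A₂)
  obtain ⟨z, hz, hza, hzb⟩ := hA'.exists_third (fun h => (h ▸ hlt).not_ge le_top) a b
  -- The pair `ab` does not separate `A`, so a nonempty part attached only at `a` and `b` is all the
  -- rest, including `z`.
  have hF : ∀ T ⊆ A.verts, T.Nonempty → a ∉ T → b ∉ T →
      (∀ u ∈ T, ∀ v ∈ A.verts, G.Adj u v → v ∈ T ∨ v = a ∨ v = b) → z ∈ T := by
    intro T hT hne haT hbT hcl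
    have := eq_of_closed_of_isKSumComponent hab hA ha hb hno hT hne haT hbT hcl
    have hz' := hlt.le.1 hz
    rw [this] at hz'
    exact (hz'.resolve_left hza).resolve_left hzb
  -- a nonempty part `T` that misses `A'` cannot be attached at one vertex
  have hone : ∀ T ⊆ A.verts, T.Nonempty → a ∉ T → b ∉ T → z ∉ T → ∀ x,
      ¬ ∀ u ∈ T, ∀ v ∈ A.verts, G.Adj u v → v ∈ T ∨ v = x := by
    intro T hT hne haT hbT hzT x hcl
    by_cases hx : x ∈ A.verts ∧ x ∉ T ∧ x ≠ a ∧ x ≠ b ∧ ∃ u ∈ T, G.Adj u x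
    swap
    · refine hzT (hF T hT hne haT hbT fun u hu v hv huv => ?_)
      rcases hcl u hu v hv huv with h | rfl
      · exact .inl h
      · by_contra! hcon
        exact hx ⟨hv, hcon.1, hcon.2.1, hcon.2.2, u, hu, huv⟩
    obtain ⟨hxA, hxT, hxa, hxb, u, hu, hux⟩ := hx
    have hua : u ≠ a := fun h => haT (h ▸ hu)
    have hub : u ≠ b := fun h => hbT (h ▸ hu)
    have hTu : T \ {u} = ∅ := hE x hxA u (hT hu) hux.symm _ (Set.sdiff_subset.trans hT)
      (fun h => haT h.1) (fun h => hbT h.1) (fun h => hxT h.1) (fun h => h.2 rfl) (by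
        rintro t ⟨ht, -⟩ v hv htv
        rcases hcl t ht v hv htv with h | h
        · by_cases hvu : v = u
          · simp [hvu]
          · exact .inl ⟨h, hvu⟩
        · simp [h])
    have hTu : T = {u} :=
      Set.Subset.antisymm (Set.sdiff_eq_empty.1 hTu) (Set.singleton_subset_iff.2 hu)
    have hxu : ∀ v ∈ A.verts, G.Adj x v → v = u := by
      intro v hv hxv
      by_contra hvu
      refine hne.ne_empty (hE x hxA v hv hxv T hT haT hbT hxT ?_ fun t ht w hw htw => ?_)
      · rw [hTu]; exact hvu
      · rcases hcl t ht w hw htw with h | h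
        · exact .inl h
        · exact .inr (.inl h)
    have hux' : ∀ v ∈ A.verts, G.Adj u v → v = x := by
      intro v hv huv
      rcases hcl u hu v hv huv with h | h
      · rw [hTu] at h
        exact absurd h.symm huv.ne
      · exact h
    -- Now `x` and `u` are adjacent only to each other within `A`, so `A` has just the vertices `a`,
    -- `b`, `x`, `u`, and that case lies in a 2-tree.
    refine hcon ?_
    rw [eq_of_closed_of_isKSumComponent hab hA ha hb hno (T := {x, u})
      (by rintro v (rfl | rfl); exacts [hxA, hT hu]) ⟨x, by simp⟩
      (by rintro (h | h) <;> simp_all) (by rintro (h | h) <;> simp_all) (by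
        rintro v (rfl | rfl) w hw hvw
        · simp [hxu w hw hvw]
        · simp [hux' w hw hvw])]
    exact hasTwoTree_of_four hab hxa.symm hua.symm hxb.symm hub.symm hux.ne.symm hGab
      fun h => hxa (hux' a ha h.symm).symm
  have htwo : ∀ T ⊆ A.verts, T.Nonempty → a ∉ T → b ∉ T → z ∉ T → ∀ x y,
      (G ⊔ SimpleGraph.edge a b).Adj x y → x ∉ T → y ∉ T →
      ¬ ∀ u ∈ T, ∀ v ∈ A.verts, G.Adj u v → v ∈ T ∨ v = x ∨ v = y := by
    intro T hT hne haT hbT hzT x y hxy hxT hyT hcl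
    by_cases hx : x ∈ A.verts
    swap
    · refine hone T hT hne haT hbT hzT y fun u hu v hv huv => ?_
      rcases hcl u hu v hv huv with h | rfl | h
      · exact .inl h
      · contradiction
      · exact .inr h
    by_cases hy : y ∈ A.verts
    swap
    · refine hone T hT hne haT hbT hzT x fun u hu v hv huv => ?_
      rcases hcl u hu v hv huv with h | h | rfl
      · exact .inl h
      · exact .inr h
      · contradiction
    rcases hxy with hxy | hxy
    · exact hne.ne_empty (hE x hx y hy hxy T hT haT hbT hxT hyT hcl)
    · rw [SimpleGraph.edge_adj] at hxy
      refine hzT (hF T hT hne haT hbT fun u hu v hv huv => ?_)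
      have := hcl u hu v hv huv
      rcases hxy with ⟨⟨rfl, rfl⟩ | ⟨rfl, rfl⟩, -⟩
      · exact this
      · tauto
  -- Along the splittings leading to `A'`, no vertex of `A` is ever lost: a lost part would be
  -- attached to the rest of `A` only at the hinge, which `htwo` forbids. Hence `A` lies in `A'`.
  have hstep : ∀ {D D₁ D₂ : (G ⊔ SimpleGraph.edge a b).Subgraph},
      IsKSumComponent 2 (G ⊔ SimpleGraph.edge a b) D → IsKSum 2 D D₁ D₂ →
      A.verts ⊆ D.verts → A'.verts ⊆ D₁.verts → A.verts ⊆ D₁.verts := by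
    intro D D₁ D₂ hD hs hAD hAD'
    by_contra hsub
    obtain ⟨t, htA, htD⟩ := Set.not_subset.1 hsub
    obtain ⟨x, y, -, hv, hxy, -⟩ := hs.exists_pair
    refine htwo (A.verts \ D₁.verts) Set.sdiff_subset ⟨t, htA, htD⟩ (fun h => h.2 (hAD' ha'))
      (fun h => h.2 (hAD' hb')) (fun h => h.2 (hAD' hz)) x y hxy.adj_sub
      (fun h => h.2 hxy.fst_mem) (fun h => h.2 hxy.snd_mem) fun u hu v hvA huv => ?_
    have h := hD.adj (hAD hu.1) (hAD hvA) (.inl huv)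
    rw [← hs.1] at h
    have h := h.resolve_left fun h => hu.2 h.fst_mem
    by_cases hvD : v ∈ D₁.verts
    · have : v ∈ D₁.verts ∩ D₂.verts := ⟨hvD, h.snd_mem⟩
      rw [hv] at this
      exact .inr this
    · exact .inl ⟨hvA, hvD⟩
  have hall : ∀ D, IsKSumComponent 2 (G ⊔ SimpleGraph.edge a b) D → A'.verts ⊆ D.verts →
      A.verts ⊆ D.verts := by
    intro D hD
    induction hD with
    | whole => exact fun _ => Set.subset_univ _
    | left hD hs ih =>
      exact fun h => hstep hD hs (ih (h.trans (by rw [← hs.1]; exact Set.subset_union_left))) h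
    | right hD hs ih =>
      exact fun h => hstep hD hs.symm
        (ih (h.trans (by rw [← hs.1]; exact Set.subset_union_right))) h
  have hsub := hall A' hA' subset_rfl
  exact hlt.not_ge ⟨hsub, fun u v huv => hA'.adj (hsub huv.fst_mem) (hsub huv.snd_mem) huv.adj_sub⟩

/-! ### Interpolating between realizations -/

/-- Lengths between those of two realizations are attained on a partial `2`-tree. -/
theorem IsPartialKTree.exists_realization {V : Type*} {G H : SimpleGraph V} {A : H.Subgraph}
    (h : IsPartialKTree 2 A.coe) {a b : V} (hab : A.Adj a b) {p q : V → EuclideanSpace ℝ (Fin 2)}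
    (hpq : ∀ u v, G.Adj u v → dist (p u) (p v) = dist (q u) (q v)) {t : ℝ}
    (ht₀ : dist (p a) (p b) ≤ t) (ht₁ : t ≤ dist (q a) (q b)) :
    ∃ r : V → EuclideanSpace ℝ (Fin 2),
      (∀ u v, A.Adj u v → G.Adj u v → dist (r u) (r v) = dist (p u) (p v)) ∧
        dist (r a) (r b) = t := by
  have ht : 0 ≤ t := dist_nonneg.trans ht₀
  have hsq : t ^ 2 ∈ segment ℝ (dist (p a) (p b) ^ 2) (dist (q a) (q b) ^ 2) := by
    rw [segment_eq_Icc (by gcongr; exact ht₀.trans ht₁)]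
    exact ⟨by gcongr, by gcongr⟩
  obtain ⟨α, β, hα, hβ, hαβ, hsum⟩ := hsq
  -- Square roots of the weights make squared distances combine with weights `α` and `β`. Edges of
  -- `G`, equally long in `p` and `q`, keep their length.
  let P : V → WithLp 2 (EuclideanSpace ℝ (Fin 2) × EuclideanSpace ℝ (Fin 2)) :=
    fun u => WithLp.toLp 2 (√α • p u, √β • q u)
  have hP : ∀ u v, dist (P u) (P v) ^ 2 =
      α * dist (p u) (p v) ^ 2 + β * dist (q u) (q v) ^ 2 := by
    intro u v
    rw [WithLp.prod_dist_eq_of_L2, Real.sq_sqrt (by positivity)]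
    change dist (√α • p u) (√α • p v) ^ 2 + dist (√β • q u) (√β • q v) ^ 2 = _
    simp only [dist_smul₀, mul_pow, Real.norm_eq_abs, sq_abs, Real.sq_sqrt hα, Real.sq_sqrt hβ]
  obtain ⟨r, hr⟩ := h.exists_flattening P
  refine ⟨r, fun u v huv hG => ?_, ?_⟩
  · rw [hr u v huv, ← sq_eq_sq₀ dist_nonneg dist_nonneg, hP, ← hpq u v hG, ← add_mul, hαβ, one_mul]
  · rw [hr a b hab, ← sq_eq_sq₀ dist_nonneg ht, hP]
    exact hsum

theorem IsKSumComponent.exists_realization {V : Type*} [Finite V] {G : SimpleGraph V} {a b : V}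
    (hab : a ≠ b) (hGab : ¬ G.Adj a b)
    (hmin : ∀ A, IsMinimalKSumComponentContaining 2 (G ⊔ SimpleGraph.edge a b) a b A →
      IsPartialKTree 2 A.coe)
    {p q : V → EuclideanSpace ℝ (Fin 2)}
    (hpq : ∀ u v, G.Adj u v → dist (p u) (p v) = dist (q u) (q v)) {t : ℝ}
    (ht₀ : dist (p a) (p b) ≤ t) (ht₁ : t ≤ dist (q a) (q b))
    {A : (G ⊔ SimpleGraph.edge a b).Subgraph}
    (hA : IsKSumComponent 2 (G ⊔ SimpleGraph.edge a b) A) (ha : a ∈ A.verts) (hb : b ∈ A.verts) :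
    ∃ r : V → EuclideanSpace ℝ (Fin 2),
      (∀ u v, A.Adj u v → G.Adj u v → dist (r u) (r v) = dist (p u) (p v)) ∧
        dist (r a) (r b) = t := by
  induction hn : A.verts.ncard using Nat.strong_induction_on generalizing A with
  | _ n ih =>
  have habA : A.Adj a b := hA.adj ha hb (.inr (by simp [SimpleGraph.edge_adj, hab]))
  by_cases hdec : ∃ A₁ A₂, IsKSum 2 A A₁ A₂
  · obtain ⟨A₁, A₂, hs, ha₁, hb₁, hA₁, hA₂⟩ : ∃ A₁ A₂, IsKSum 2 A A₁ A₂ ∧ a ∈ A₁.verts ∧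
        b ∈ A₁.verts ∧ IsKSumComponent 2 (G ⊔ SimpleGraph.edge a b) A₁ ∧
        IsKSumComponent 2 (G ⊔ SimpleGraph.edge a b) A₂ := by
      obtain ⟨A₁, A₂, hs⟩ := hdec
      have h := habA
      rw [← hs.1] at h
      rcases h with h | h
      · exact ⟨A₁, A₂, hs, h.fst_mem, h.snd_mem, .left hA hs, .right hA hs⟩
      · exact ⟨A₂, A₁, hs.symm, h.fst_mem, h.snd_mem, .right hA hs, .left hA hs⟩
    obtain ⟨x, y, hxy, hv, hxy₁, hxy₂, ⟨z₁, hz₁, hz₁'⟩, z₂, hz₂, hz₂'⟩ := hs.exists_pair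
    have hlt : ∀ {S : Set V} {z}, S ⊆ A.verts → z ∈ A.verts → z ∉ S → S.ncard < n :=
      fun hS hz hz' => hn ▸ Set.ncard_lt_ncard ⟨hS, fun h => hz' (h hz)⟩ (Set.toFinite _)
    have hverts : A₁.verts ∪ A₂.verts = A.verts := by rw [← hs.1]; rfl
    obtain ⟨r₁, hr₁, hr₁t⟩ := ih _ (hlt (hverts ▸ Set.subset_union_left) (hverts ▸ .inr hz₂) hz₂')
      hA₁ ha₁ hb₁ rfl
    obtain ⟨r₂, hr₂, hr₁₂⟩ : ∃ r₂ : V → EuclideanSpace ℝ (Fin 2),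
        (∀ u v, A₂.Adj u v → G.Adj u v → dist (r₂ u) (r₂ v) = dist (p u) (p v)) ∧
        dist (r₁ x) (r₁ y) = dist (r₂ x) (r₂ y) := by
      rcases hxy₁.adj_sub with hG | hf
      -- A hinge in `G` already has its prescribed length under `r₁`, so the other summand can keep
      -- the placement `p`.
      · exact ⟨p, fun _ _ _ _ => rfl, hr₁ x y hxy₁ hG⟩
      -- A hinge equal to `ab` has to be given length `t` on both sides, so the induction is applied
      -- to the second summand too.
      · rw [SimpleGraph.edge_adj] at hf
        have hx : x ∈ A₂.verts := hxy₂.fst_mem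
        have hy : y ∈ A₂.verts := hxy₂.snd_mem
        have hab₂ : a ∈ A₂.verts ∧ b ∈ A₂.verts := by
          rcases hf with ⟨⟨rfl, rfl⟩ | ⟨rfl, rfl⟩, -⟩
          · exact ⟨hx, hy⟩
          · exact ⟨hy, hx⟩
        obtain ⟨r₂, hr₂, hr₂t⟩ := ih _
          (hlt (hverts ▸ Set.subset_union_right) (hverts ▸ .inl hz₁) hz₁') hA₂ hab₂.1 hab₂.2 rfl
        refine ⟨r₂, hr₂, ?_⟩
        rcases hf with ⟨⟨rfl, rfl⟩ | ⟨rfl, rfl⟩, -⟩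
        · rw [hr₁t, hr₂t]
        · rw [dist_comm, hr₁t, dist_comm, hr₂t]
    obtain ⟨r, hrl, hrr⟩ := exists_glued r₁ r₂ hv hr₁₂
    refine ⟨r, fun u v huv hG => ?_, by rw [hrl a ha₁, hrl b hb₁, hr₁t]⟩
    rw [← hs.1] at huv
    rcases huv with huv | huv
    · rw [hrl u huv.fst_mem, hrl v huv.snd_mem, hr₁ u v huv hG]
    · rw [hrr u huv.fst_mem v huv.snd_mem, hr₂ u v huv hG]
  · push Not at hdec
    suffices h : IsPartialKTree 2 A.coe from h.exists_realization habA hpq ht₀ ht₁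
    by_cases hAmin : IsMinimalKSumComponentContaining 2 (G ⊔ SimpleGraph.edge a b) a b A
    · exact hmin A hAmin
    · obtain ⟨A', hlt, hA', ha', hb'⟩ := exists_lt_of_not_minimal
        (P := fun B => IsKSumComponent 2 (G ⊔ SimpleGraph.edge a b) B ∧ a ∈ B.verts ∧ b ∈ B.verts)
        ⟨hA, ha, hb⟩ hAmin
      refine (hasTwoTree_of_not_minimal hab hGab hA ha hb hdec hA' ha' hb' hlt).isPartialKTree
        fun u v huv => ?_
      have h := huv.adj_sub
      rw [SimpleGraph.sup_adj, SimpleGraph.edge_adj] at h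
      tauto

theorem theorem1 {V : Type*} [Finite V] (G : SimpleGraph V) (v₁ v₂ : V)
    (hne : v₁ ≠ v₂) (hf : ¬ G.Adj v₁ v₂) :
    (∀ δ : G.edgeSet → ℝ≥0, (cayleyConfigurationSpace 2 G v₁ v₂ δ).OrdConnected) ↔
      ∀ A : (G ⊔ SimpleGraph.edge v₁ v₂).Subgraph,
        IsMinimalKSumComponentContaining 2 (G ⊔ SimpleGraph.edge v₁ v₂) v₁ v₂ A →
          IsPartialKTree 2 A.coe := by
  constructor
  · intro h A hA
    obtain ⟨⟨hAc, h₁, h₂⟩, hAmin⟩ := hA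
    -- A summand containing `ab` would be a smaller such component, because the other summand has a
    -- vertex outside it.
    have hE := edgeInseparable_of_isKSumComponent hne hf hAc h₁ h₂ fun A₁ A₂ hs h₁' h₂' => by
      obtain ⟨x, y, -, -, -, -, -, z, hz, hz'⟩ := hs.exists_pair
      have hle := hAmin ⟨.left hAc hs, h₁', h₂'⟩ (by rw [← hs.1]; exact le_sup_left)
      exact hz' (hle.1 (by rw [← hs.1]; exact .inr hz))
    refine (hasTwoTree_of_edgeInseparable hne h₁ h₂ hf hE ?_).isPartialKTree fun u v huv => ?_
    · rintro ⟨B₁, B₂, C, D, hK, -⟩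
      obtain ⟨δ, hδ⟩ := hK.not_ordConnected
      exact hδ (h δ)
    · have h := huv.adj_sub
      rw [SimpleGraph.sup_adj, SimpleGraph.edge_adj] at h
      tauto
  · intro h δ
    refine ⟨?_⟩
    rintro _ ⟨p, hp, rfl⟩ _ ⟨q, hq, rfl⟩ t ⟨ht₀, ht₁⟩
    obtain ⟨r, hr, hrt⟩ := (IsKSumComponent.whole (k := 2)).exists_realization hne hf h
      (fun u v huv => (hp u v huv).trans (hq u v huv).symm) ht₀ ht₁ (Set.mem_univ _)
      (Set.mem_univ _)
    exact ⟨r, fun u v huv => (hr u v (.inl huv) huv).trans (hp u v huv), hrt⟩
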